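/- Let $m\ge 0$ and $n\ge 0$. Let $\omega(p)=\sqrt{|p|^2+m^2}$ for $p\in\mathbb R^3$, let $d\Omega_m(p)=d^3p/\omega(p)$, and let $\mathcal H=\bigoplus_{N\ge0}\mathcal H_N$ be the Fock space in which $\mathcal H_N$ consists of the symmetric square-integrable functions of $N$ momenta with respect to $\prod_k d\Omega_m(\xi_k)$; a momentum $\xi\in\mathbb R^3$ is identified with the four-vector $(\omega(\xi),\xi)$ on the mass hyperboloid. Let $\Phi_0=(1,0,0,\dots)$ be the vacuum. For $f\in\mathcal S(\mathbb R^4)$ put $\tilde f(p)=(2\pi)^{-2}\int e^{-ip\cdot x}f(x)\,d^4x$ with the Minkowski product $p\cdot x=p^0x^0-p^1x^1-p^2x^2-p^3x^3$. Let $\phi$ be the free neutral scalar field of mass $m$; its Wick powers are the unbounded operators on $\mathcal H$ given by $$({:}\phi^l{:}(f)\Phi)^{(N)}(\xi_1,\dots,\xi_N)=\frac{\pi^{l/2}}{(2\pi)^{2(l-1)}}\sum_{j=0}^{l}\Big[\frac{(N-l+2j)!}{N!}\Big]^{1/2}\sum_{\substack{S\subset\{1,\dots,N\}\\|S|=l-j}}\frac{l!}{j!}\int\prod_{r=1}^{j}d\Omega_m(\eta_r)\,\tilde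 f\Big(\sum_{r}\eta_r-\sum_{k\in S}\xi_k\Big)\Phi^{(N-l+2j)}\big(\eta_1,\dots,\eta_j,(\xi_k)_{k\notin S}\big)$$ on the domain of all $\Phi\in\mathcal H$ for which these integrals converge absolutely for almost all $\xi$ and the result lies in $\mathcal H$. Let $$D_m^{(-)}(z^0,\mathbf x)=\frac1{2(2\pi)^3}\int_{\mathbb R^3}\frac{e^{-i\omega(p)z^0+ip\cdot\mathbf x}}{\omega(p)}\,d^3p\qquad(\operatorname{Im}z^0<0).$$ Let $\sigma^{(i)}={:}e^{g_i\phi}{:}=\sum_{l\ge0}g_i^l\,{:}\phi^l{:}/l!$, a formal power series in the indeterminate $g_i$, for $i=1,\dots,n$. Then $$(\Phi_0,\sigma^{(1)}(x_1)\cdots\sigma^{(n)}(x_n)\Phi_0)=\exp\Big\{\sum_{1\le i<j\le n}g_ig_jt_{ij}\Big\},\qquad t_{ij}=D_m^{(-)}(x_i-x_j),$$ as an identity of formal power series in $g_1,\dots,g_n$ whose coefficients are distributions in $x_1,\dots,x_n$. That is, for all $f_1,\dots,f_n\in\mathcal S(\mathbb R^4)$ and all $k\in\mathbb N^n$: 1.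 $\Phi_0$ lies in the domain of ${:}\phi^{k_1}{:}(f_1)\cdots{:}\phi^{k_n}{:}(f_n)$. 2. Let $c_k(y;x)$ be the coefficient of $g_1^{k_1}\cdots g_n^{k_n}$ in the formal power series $\exp\{\sum_{i<j}g_ig_jD_m^{(-)}(z_i-z_j)\}$ with $z_i=(x_i^0+iy_i,\mathbf x_i)$. For all real $y_1<\dots<y_n$, the function $x\mapsto c_k(y;x)\prod_if_i(x_i)$ is integrable on $\mathbb R^{4n}$. 3. As $y\to0$ within $\{y_1<\dots<y_n\}$, $$\int_{\mathbb R^{4n}}c_k(y;x)\prod_{i=1}^nf_i(x_i)\,dx\ \longrightarrow\ \frac{1}{k_1!\cdots k_n!}\big(\Phi_0,{:}\phi^{k_1}{:}(f_1)\cdots{:}\phi^{k_n}{:}(f_n)\Phi_0\big).$$ -/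

import Mathlib

open MeasureTheory Filter Topology
open scoped SchwartzMap Nat

noncomputable section

namespace WickExp

/-! ### Kinematics -/

/-- Minkowski space `ℝ⁴`; the coordinate `0` is the time. -/
abbrev Spacetime : Type := EuclideanSpace ℝ (Fin 4)

/-- Three-dimensional momentum space. It parametrizes the mass hyperboloid
`ξ² = m²`, `ξ⁰ > 0` by the spatial part of the four-momentum. -/
abbrev Momentum : Type := EuclideanSpace ℝ (Fin 3)

/-- The relativistic energy `ω(p) = √(|p|² + m²)`. -/
def energy (m : ℝ) (p : Momentum) : ℝ := √(‖p‖ ^ 2 + m ^ 2)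

/-- The four-momentum `(ω(p), p)` on the mass hyperboloid. -/
def onShell (m : ℝ) (p : Momentum) : Spacetime :=
  !₂[energy m p, p 0, p 1, p 2]

/-- The Minkowski product `p⁰x⁰ - p¹x¹ - p²x² - p³x³`. -/
def mink (p x : Spacetime) : ℝ := p 0 * x 0 - p 1 * x 1 - p 2 * x 2 - p 3 * x 3

/-- The Lorentz invariant measure `dΩ_m = dξ¹dξ²dξ³ / √(|ξ|² + m²)` on the mass hyperboloid. -/
def Omega (m : ℝ) : Measure Momentum :=
  volume.withDensity fun p => ENNReal.ofReal (1 / energy m p)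

instance (m : ℝ) : SigmaFinite (Omega m) := by
  unfold Omega
  exact SigmaFinite.withDensity_ofReal _

/-- The product measure `∏ dΩ_m(ξ_k)` on families of momenta. -/
abbrev OmegaPi (m : ℝ) (ι : Type) [Fintype ι] : Measure (ι → Momentum) :=
  Measure.pi fun _ : ι => Omega m

/-- The Fourier transform `f̃(p) = (2π)⁻² ∫ e^{-ip·x} f(x) d⁴x`, with the Minkowski product. -/
def ftilde (f : 𝓢(Spacetime, ℂ)) (p : Spacetime) : ℂ :=
  ((2 * Real.pi : ℝ) : ℂ)⁻¹ ^ 2 * ∫ x : Spacetime, Complex.exp (-Complex.I * (mink p x : ℂ)) * f x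

/-- The two-point function at a point with complex time,
`D_m^{(-)}(z⁰, x) = [2(2π)³]⁻¹ ∫ ω(p)⁻¹ e^{-iω(p)z⁰} e^{ip·x} d³p`, given for `Im z⁰ < 0` by an
absolutely convergent integral. The point `(z⁰, x)` has `z⁰ = x⁰ + i s`. -/
def twoPoint (m : ℝ) (x : Spacetime) (s : ℝ) : ℂ :=
  ((2 * (2 * Real.pi) ^ 3 : ℝ) : ℂ)⁻¹ *
    ∫ p : Momentum, ((energy m p : ℝ) : ℂ)⁻¹ *
      Complex.exp (-Complex.I * (energy m p : ℂ) * ((x 0 : ℂ) + Complex.I * (s : ℂ))) *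
      Complex.exp (Complex.I * ((p 0 * x 1 + p 1 * x 2 + p 2 * x 3 : ℝ) : ℂ))

/-! ### Fock space -/

lemma quasi_comp (m : ℝ) {ι κ : Type} [Fintype ι] [Fintype κ] (g : κ → ι)
    (hg : Function.Injective g) :
    Measure.QuasiMeasurePreserving (fun ξ : ι → Momentum => ξ ∘ g) (OmegaPi m ι) (OmegaPi m κ) := by
  classical
  have h1 := measurePreserving_piEquivPiSubtypeProd (fun _ : ι => Omega m) (fun i => ∃ k, g k = i)
  let e : {i // ∃ k, g k = i} ≃ κ := (Equiv.ofInjective g hg).symm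
  have h3 := measurePreserving_piCongrLeft (fun _ : κ => Omega m) e
  have h := h3.quasiMeasurePreserving.comp
    (Measure.quasiMeasurePreserving_fst.comp h1.quasiMeasurePreserving)
  convert h using 1
  funext ξ k
  have : k = e ⟨g k, k, rfl⟩ := (Equiv.ofInjective_symm_apply hg k).symm
  conv_rhs => rw [this]
  simp only [Function.comp_apply]
  erw [MeasurableEquiv.coe_piCongrLeft, Equiv.piCongrLeft_apply_apply]
  rfl

/-- The symmetric square-integrable functions of `N` momenta, with respect to `∏ dΩ_m(ξ_k)`. -/
def symL2 (m : ℝ) (N : ℕ) : Submodule ℂ (Lp ℂ 2 (OmegaPi m (Fin N))) where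
  carrier := {F | ∀ σ : Equiv.Perm (Fin N), ∀ᵐ ξ ∂(OmegaPi m (Fin N)), F (ξ ∘ σ) = F ξ}
  zero_mem' := by
    intro σ
    have h0 := Lp.coeFn_zero ℂ 2 (OmegaPi m (Fin N))
    filter_upwards [h0, (quasi_comp m σ σ.injective).ae h0] with ξ h1 h2
    rw [h1, h2]; rfl
  add_mem' := by
    intro F G hF hG σ
    have h0 := Lp.coeFn_add F G
    filter_upwards [h0, (quasi_comp m σ σ.injective).ae h0, hF σ, hG σ] with ξ h1 h2 h3 h4
    rw [h1, h2]; simp [h3, h4]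
  smul_mem' := by
    intro c F hF σ
    have h0 := Lp.coeFn_smul c F
    filter_upwards [h0, (quasi_comp m σ σ.injective).ae h0, hF σ] with ξ h1 h2 h3
    rw [h1, h2]; simp [h3]

/-- The Fock space `ℋ = ⊕_N ℋ_N` (Hilbert sum) over the mass hyperboloid. -/
abbrev Fock (m : ℝ) : Type := lp (fun N : ℕ => symL2 m N) 2

/-- The `N`-particle wave function of a Fock space vector. -/
def wave {m : ℝ} (Φ : Fock m) (N : ℕ) : (Fin N → Momentum) → ℂ :=
  ((Φ N : symL2 m N) : Lp ℂ 2 (OmegaPi m (Fin N)))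

lemma memLp_one (m : ℝ) : MemLp (fun _ : Fin 0 → Momentum => (1 : ℂ)) 2 (OmegaPi m (Fin 0)) := by
  rw [OmegaPi, Measure.pi_of_empty _ (fun i => i.elim0)]
  exact memLp_const 1

/-- The vacuum vector `Φ₀ = (1, 0, 0, …)`. -/
def vacuum (m : ℝ) : Fock m :=
  lp.single 2 0 ⟨(memLp_one m).toLp, fun σ => by
    have : ∀ ξ : Fin 0 → Momentum, ξ ∘ σ = ξ := fun ξ => Subsingleton.elim _ _
    simp [this]⟩

/-! ### Wick powers of the free field -/

/-- The integrand `f̃(∑ η_r - ∑_{k ∈ S} ξ_k) Φ(η₁, …, η_j, (ξ_k)_{k ∉ S})`. -/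
def wickIntegrand (m : ℝ) (f : 𝓢(Spacetime, ℂ)) (Φ : (M : ℕ) → (Fin M → Momentum) → ℂ)
    {N : ℕ} (ξ : Fin N → Momentum) (S : Finset (Fin N)) (j : ℕ) (η : Fin j → Momentum) : ℂ :=
  ftilde f (∑ r, onShell m (η r) - ∑ k ∈ S, onShell m (ξ k)) *
    Φ (j + Sᶜ.card) (Fin.append η (ξ ∘ Sᶜ.orderEmbOfFin rfl))

/-- The `N`-particle component at `(ξ₁, …, ξ_N)` of `:φ^l:(f)Φ`:
`π^{l/2} (2π)^{-2(l-1)} ∑_{j=0}^{l} [(N-l+2j)!/N!]^{1/2} ∑_{|S| = l-j} (l!/j!)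
  ∫ ∏ dΩ_m(η_r) f̃(∑ η_r - ∑_{k ∈ S} ξ_k) Φ^{(N-l+2j)}(η₁, …, η_j, (ξ_k)_{k ∉ S})`.
The factor `l!` is the sum over the permutations of the `l` variables `η_r`, `-ξ_k`. The inner sum
is empty when `N < l - j`, so the subtraction is never truncated in a term that occurs. -/
def wickValue (m : ℝ) (l : ℕ) (f : 𝓢(Spacetime, ℂ)) (Φ : (M : ℕ) → (Fin M → Momentum) → ℂ)
    (N : ℕ) (ξ : Fin N → Momentum) : ℂ :=
  ((√Real.pi ^ l / (2 * Real.pi) ^ (2 * ((l : ℤ) - 1)) : ℝ) : ℂ) *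
    ∑ j ∈ Finset.range (l + 1), ((√(((N + 2 * j - l)! : ℝ) / (N ! : ℝ)) : ℝ) : ℂ) *
      ∑ S ∈ Finset.powersetCard (l - j) (Finset.univ : Finset (Fin N)),
        ((l ! : ℂ) / (j ! : ℂ)) * ∫ η, wickIntegrand m f Φ ξ S j η ∂(OmegaPi m (Fin j))

/-- All integrals that occur in `wickValue m l f Φ N ξ` converge absolutely. -/
def WickConverges (m : ℝ) (l : ℕ) (f : 𝓢(Spacetime, ℂ)) (Φ : (M : ℕ) → (Fin M → Momentum) → ℂ)
    (N : ℕ) (ξ : Fin N → Momentum) : Prop :=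
  ∀ j ∈ Finset.range (l + 1),
    ∀ S ∈ Finset.powersetCard (l - j) (Finset.univ : Finset (Fin N)),
      Integrable (wickIntegrand m f Φ ξ S j) (OmegaPi m (Fin j))

lemma quasi_append (m : ℝ) {N j q : ℕ} (e : Fin q → Fin N) (he : Function.Injective e) :
    Measure.QuasiMeasurePreserving
      (fun p : (Fin N → Momentum) × (Fin j → Momentum) => Fin.append p.2 (p.1 ∘ e))
      ((OmegaPi m (Fin N)).prod (OmegaPi m (Fin j))) (OmegaPi m (Fin (j + q))) := by
  have h1 := (measurePreserving_sumPiEquivProdPi_symm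
    (fun _ : Fin N ⊕ Fin j => Omega m)).quasiMeasurePreserving
  let g : Fin (j + q) → Fin N ⊕ Fin j := Fin.append (fun r => Sum.inr r) (fun r => Sum.inl (e r))
  have hg : Function.Injective g := by
    intro a b
    refine Fin.addCases (fun a => ?_) (fun a => ?_) a <;>
      refine Fin.addCases (fun b => ?_) (fun b => ?_) b <;> simp [g, he.eq_iff]
  have h := (quasi_comp m g hg).comp h1
  convert h using 1
  funext p a
  refine Fin.addCases (fun a => ?_) (fun a => ?_) a
  · simp [g, MeasurableEquiv.sumPiEquivProdPi, Equiv.sumPiEquivProdPi]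
  · simp [g, MeasurableEquiv.sumPiEquivProdPi, Equiv.sumPiEquivProdPi]

lemma ae_wave {m : ℝ} {j q N : ℕ} {P : (Fin (j + q) → Momentum) → Prop}
    (h : ∀ᵐ ζ ∂(OmegaPi m (Fin (j + q))), P ζ) (e : Fin q → Fin N) (he : Function.Injective e) :
    ∀ᵐ ξ ∂(OmegaPi m (Fin N)), ∀ᵐ η ∂(OmegaPi m (Fin j)), P (Fin.append η (ξ ∘ e)) :=
  Measure.ae_ae_of_ae_prod ((quasi_append m e he).ae h)

lemma wave_add {m : ℝ} (Φ Ψ : Fock m) (N : ℕ) :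
    ∀ᵐ ξ ∂(OmegaPi m (Fin N)), wave (Φ + Ψ) N ξ = wave Φ N ξ + wave Ψ N ξ :=
  Lp.coeFn_add _ _

lemma wave_smul {m : ℝ} (c : ℂ) (Φ : Fock m) (N : ℕ) :
    ∀ᵐ ξ ∂(OmegaPi m (Fin N)), wave (c • Φ) N ξ = c * wave Φ N ξ :=
  Lp.coeFn_smul _ _

lemma wave_zero {m : ℝ} (N : ℕ) :
    ∀ᵐ ξ ∂(OmegaPi m (Fin N)), wave (0 : Fock m) N ξ = 0 :=
  Lp.coeFn_zero _ _ _

lemma wickIntegrand_ae {m : ℝ} (f : 𝓢(Spacetime, ℂ)) {Φ : (M : ℕ) → (Fin M → Momentum) → ℂ}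
    {Φ' : (M : ℕ) → (Fin M → Momentum) → ℂ}
    (h : ∀ M, ∀ᵐ ζ ∂(OmegaPi m (Fin M)), Φ M ζ = Φ' M ζ) (N : ℕ) :
    ∀ᵐ ξ ∂(OmegaPi m (Fin N)), ∀ (S : Finset (Fin N)) (j : ℕ),
      wickIntegrand m f Φ ξ S j =ᵐ[OmegaPi m (Fin j)] wickIntegrand m f Φ' ξ S j := by
  rw [ae_all_iff]; intro S
  rw [ae_all_iff]; intro j
  filter_upwards [ae_wave (h (j + Sᶜ.card)) (Sᶜ.orderEmbOfFin rfl)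
    (Sᶜ.orderEmbOfFin rfl).injective] with ξ hξ
  filter_upwards [hξ] with η hη
  simp only [wickIntegrand, hη]

lemma wick_congr {m : ℝ} {l : ℕ} {f : 𝓢(Spacetime, ℂ)} {N : ℕ} {ξ : Fin N → Momentum}
    {Φ Φ' : (M : ℕ) → (Fin M → Momentum) → ℂ}
    (h : ∀ (S : Finset (Fin N)) (j : ℕ),
      wickIntegrand m f Φ ξ S j =ᵐ[OmegaPi m (Fin j)] wickIntegrand m f Φ' ξ S j) :
    wickValue m l f Φ N ξ = wickValue m l f Φ' N ξ ∧
      (WickConverges m l f Φ N ξ ↔ WickConverges m l f Φ' N ξ) := by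
  constructor
  · simp only [wickValue, integral_congr_ae (h _ _)]
  · simp only [WickConverges, integrable_congr (h _ _)]

lemma wick_add {m : ℝ} {l : ℕ} {f : 𝓢(Spacetime, ℂ)} {N : ℕ} {ξ : Fin N → Momentum}
    {Φ Φ' : (M : ℕ) → (Fin M → Momentum) → ℂ}
    (h : WickConverges m l f Φ N ξ) (h' : WickConverges m l f Φ' N ξ) :
    WickConverges m l f (fun M ζ => Φ M ζ + Φ' M ζ) N ξ ∧
      wickValue m l f (fun M ζ => Φ M ζ + Φ' M ζ) N ξ
        = wickValue m l f Φ N ξ + wickValue m l f Φ' N ξ := by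
  have key : ∀ S j, wickIntegrand m f (fun M ζ => Φ M ζ + Φ' M ζ) ξ S j
      = fun η => wickIntegrand m f Φ ξ S j η + wickIntegrand m f Φ' ξ S j η := by
    intro S j; funext η; simp only [wickIntegrand, mul_add]
  refine ⟨fun j hj S hS => ?_, ?_⟩
  · rw [key]; exact (h j hj S hS).add (h' j hj S hS)
  · simp only [wickValue, key, ← mul_add, ← Finset.sum_add_distrib]
    congr 1
    refine Finset.sum_congr rfl fun j hj => ?_
    congr 1
    refine Finset.sum_congr rfl fun S hS => ?_
    rw [integral_add (h j hj S hS) (h' j hj S hS)]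

lemma wick_smul {m : ℝ} {l : ℕ} {f : 𝓢(Spacetime, ℂ)} {N : ℕ} {ξ : Fin N → Momentum}
    {Φ : (M : ℕ) → (Fin M → Momentum) → ℂ} (c : ℂ) (h : WickConverges m l f Φ N ξ) :
    WickConverges m l f (fun M ζ => c * Φ M ζ) N ξ ∧
      wickValue m l f (fun M ζ => c * Φ M ζ) N ξ = c * wickValue m l f Φ N ξ := by
  have key : ∀ S j, wickIntegrand m f (fun M ζ => c * Φ M ζ) ξ S j
      = fun η => c * wickIntegrand m f Φ ξ S j η := by
    intro S j; funext η; simp only [wickIntegrand]; ring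
  refine ⟨fun j hj S hS => ?_, ?_⟩
  · rw [key]; exact (h j hj S hS).const_mul c
  · simp only [wickValue, key, integral_const_mul, Finset.mul_sum]
    refine Finset.sum_congr rfl fun j hj => Finset.sum_congr rfl fun S hS => ?_
    ring

/-- The graph of `:φ^l:(f)` on its maximal domain: the pairs `(Φ, Ψ)` of Fock space vectors such
that, for every `N` and almost all `ξ`, the integrals in `wickValue` converge absolutely and
`Ψ^{(N)}(ξ)` is their value. -/
def wickGraph (m : ℝ) (l : ℕ) (f : 𝓢(Spacetime, ℂ)) : Submodule ℂ (Fock m × Fock m) where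
  carrier := {p | ∀ N, ∀ᵐ ξ ∂(OmegaPi m (Fin N)),
    WickConverges m l f (wave p.1) N ξ ∧ wave p.2 N ξ = wickValue m l f (wave p.1) N ξ}
  zero_mem' := by
    intro N
    have key : ∀ (ξ : Fin N → Momentum) S j,
        wickIntegrand m f (fun _ _ => 0) ξ S j = fun _ => 0 := by
      intro ξ S j; funext η; simp [wickIntegrand]
    filter_upwards [wave_zero (m := m) N, wickIntegrand_ae f (wave_zero (m := m)) N] with ξ h1 h2
    obtain ⟨h3, h4⟩ := wick_congr (l := l) h2
    refine ⟨h4.2 fun j _ S _ => by rw [key]; exact integrable_zero _ _ _, ?_⟩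
    refine h1.trans (Eq.trans ?_ h3.symm)
    simp [wickValue, key]
  add_mem' := by
    intro p q hp hq N
    filter_upwards [hp N, hq N, wave_add p.2 q.2 N,
      wickIntegrand_ae f (wave_add p.1 q.1) N] with ξ h1 h2 h3 h4
    obtain ⟨h5, h6⟩ := wick_congr (l := l) h4
    obtain ⟨h7, h8⟩ := wick_add h1.1 h2.1
    exact ⟨h6.2 h7, h3.trans (by rw [h1.2, h2.2, ← h8]; exact h5.symm)⟩
  smul_mem' := by
    intro c p hp N
    filter_upwards [hp N, wave_smul c p.2 N, wickIntegrand_ae f (wave_smul c p.1) N]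
      with ξ h1 h3 h4
    obtain ⟨h5, h6⟩ := wick_congr (l := l) h4
    obtain ⟨h7, h8⟩ := wick_smul c h1.1
    exact ⟨h6.2 h7, h3.trans (by rw [h1.2, ← h8]; exact h5.symm)⟩

/-- `wickGraph` is the graph of an operator. -/
lemma wickGraph_functional (m : ℝ) (l : ℕ) (f : 𝓢(Spacetime, ℂ)) (p : Fock m × Fock m)
    (hp : p ∈ wickGraph m l f) (h0 : p.1 = 0) : p.2 = 0 := by
  have hz := (wickGraph m l f).zero_mem
  ext1
  funext N
  apply Subtype.ext
  apply Lp.ext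
  filter_upwards [hp N, hz N] with ξ h1 h2
  have h3 : wave p.2 N ξ = wave (0 : Fock m) N ξ := by
    rw [h1.2, h0]; exact h2.2.symm
  exact h3

/-- The Wick power `:φ^l:(f)` of the free field `φ` of mass `m`, smeared with `f`, as an unbounded
operator in Fock space. -/
def wickPower (m : ℝ) (l : ℕ) (f : 𝓢(Spacetime, ℂ)) : Fock m →ₗ.[ℂ] Fock m :=
  (wickGraph m l f).toLinearPMap

/-! ### Products of unbounded operators, and the vacuum expectation values -/

/-- The product `AB` of unbounded operators, on `{x ∈ D(B) | Bx ∈ D(A)}`. -/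
def opMul {E : Type*} [AddCommGroup E] [Module ℂ E] (A B : E →ₗ.[ℂ] E) : E →ₗ.[ℂ] E :=
  A.comp (B.domRestrict ((A.domain.comap B.toFun).map B.domain.subtype)) (by
    rintro ⟨x, ⟨⟨y, hy⟩, h1, rfl⟩, h2⟩
    exact h1)

/-- The product `A₁ ⋯ A_n` of unbounded operators; the empty product is the identity. -/
def opProd {E : Type*} [AddCommGroup E] [Module ℂ E] {n : ℕ} (A : Fin n → E →ₗ.[ℂ] E) :
    E →ₗ.[ℂ] E :=
  (List.ofFn A).foldr opMul (LinearMap.id.toPMap ⊤)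

/-- The coefficient of `g^l` in the formal power series
`:e^{gφ}:(f) = ∑_l g^l :φ^l:(f) / l!`. -/
def wickExpCoeff (m : ℝ) (f : 𝓢(Spacetime, ℂ)) (l : ℕ) : Fock m →ₗ.[ℂ] Fock m :=
  ((l ! : ℂ)⁻¹) • wickPower m l f

/-- The coefficient of `g₁^{k₁} ⋯ g_n^{k_n}` in the formal product
`σ^{(1)}(f₁) ⋯ σ^{(n)}(f_n)`, where `σ^{(i)} = :e^{g_iφ}:`. -/
def wickExpProdCoeff (m : ℝ) {n : ℕ} (f : Fin n → 𝓢(Spacetime, ℂ)) (k : Fin n →₀ ℕ) :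
    Fock m →ₗ.[ℂ] Fock m :=
  opProd fun i => wickExpCoeff m (f i) (k i)

open Classical in
/-- The vacuum expectation value `(Φ₀, σ^{(1)}(f₁) ⋯ σ^{(n)}(f_n) Φ₀)`, as a formal power series
in `g₁, …, g_n`. (It is meaningful when `Φ₀` is in the domain of every coefficient of the
product.) -/
def vev (m : ℝ) {n : ℕ} (f : Fin n → 𝓢(Spacetime, ℂ)) : MvPowerSeries (Fin n) ℂ := fun k =>
  if h : vacuum m ∈ (wickExpProdCoeff m f k).domain then
    inner ℂ (vacuum m) (wickExpProdCoeff m f k ⟨vacuum m, h⟩)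
  else 0

/-- The formal power series `exp {∑_{i<j} g_i g_j t_{ij}}` in `g₁, …, g_n`. -/
def expSeries {n : ℕ} (t : Fin n → Fin n → ℂ) : MvPowerSeries (Fin n) ℂ :=
  (PowerSeries.exp ℂ).subst
    (∑ i : Fin n, ∑ j ∈ Finset.Ioi i,
      MvPowerSeries.X i * MvPowerSeries.X j * MvPowerSeries.C (t i j) : MvPowerSeries (Fin n) ℂ)

/-- The formal power series `exp {∑_{i<j} g_i g_j t_{ij}}` with `t_{ij} = D_m^{(-)}(z_i - z_j)` at
the points `z_i = (x_i⁰ + i y_i, 𝐱_i)` with complex times. -/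
def expTwoPoint (m : ℝ) {n : ℕ} (y : Fin n → ℝ) (x : Fin n → Spacetime) :
    MvPowerSeries (Fin n) ℂ :=
  expSeries fun i j => twoPoint m (x i - x j) (y i - y j)

end WickExp

end

noncomputable section

namespace WickExp

/-!
A damping `e^{-(y_i - y_{i-1}) H}`, with `H` the total energy, is inserted between consecutive Wick
powers. The damped vector is given by symmetric, rapidly decreasing wave functions depending
continuously on `y`. This puts the vacuum in the domain, and it lets `y` tend to `0`.

For strictly increasing `y` the damped vector is the smearing of an explicit state at the points
`x_1, …, x_n`, whose `N`-particle wave function at `ξ` is `∏ k_a! / √N!` times the coefficient of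
`X^k` in `exp (∑_{a<c} X_a X_c t_ac) ∏_r ∑_a X_a u_a(ξ_r)`, where `u_a` is the plane wave emitted at
`x_a`. Applying one more Wick power, at a point `x_0`, adds a variable `X_0` to this generating
function: by the binomial theorem, the momenta that it absorbs give the factors `X_0 X_a t_0a` and
the momenta that it creates give the factors `X_0 u_0(ξ_r)`. The gap `y_1 - y_0` makes the smearing
and the integrals over the absorbed momenta commute. At `N = 0` the state is a coefficient of the
exponential itself.
-/

/-! ### Coefficients of Gaussian generating functions -/

/-- The quadratic form `∑_{i<j} t_{ij} X_i X_j`, whose exponential generates the full contractions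
of `n` Wick exponentials. -/
def quadForm {n : ℕ} (t : Fin n → Fin n → ℂ) : MvPolynomial (Fin n) ℂ :=
  ∑ i : Fin n, ∑ j ∈ Finset.Ioi i,
    MvPolynomial.X i * MvPolynomial.X j * MvPolynomial.C (t i j)

/-- The linear form `∑_a c_a X_a`. -/
def linForm {R : Type*} [CommSemiring R] {n : ℕ} (c : Fin n → R) : MvPolynomial (Fin n) R :=
  ∑ a, MvPolynomial.X a * MvPolynomial.C (c a)

/-- The coefficient of `X^k` in `exp (∑_{i<j} t_{ij} X_i X_j) * Q`, as a linear functional of the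
polynomial `Q`. -/
def genCoeff {n : ℕ} (t : Fin n → Fin n → ℂ) (k : Fin n →₀ ℕ) : MvPolynomial (Fin n) ℂ →ₗ[ℂ] ℂ :=
  MvPowerSeries.coeff k ∘ₗ LinearMap.mulLeft ℂ (expSeries t) ∘ₗ
    (MvPolynomial.coeToMvPowerSeries.algHom ℂ).toLinearMap

lemma genCoeff_one {n : ℕ} (t : Fin n → Fin n → ℂ) (k : Fin n →₀ ℕ) :
    genCoeff t k 1 = MvPowerSeries.coeff k (expSeries t) := by
  simp [genCoeff]

lemma quadForm_isHomogeneous {n : ℕ} (t : Fin n → Fin n → ℂ) : (quadForm t).IsHomogeneous 2 := by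
  refine MvPolynomial.IsHomogeneous.sum _ _ _ fun i _ =>
    MvPolynomial.IsHomogeneous.sum _ _ _ fun j _ => ?_
  simpa using ((MvPolynomial.isHomogeneous_X ℂ i).mul (MvPolynomial.isHomogeneous_X ℂ j)).mul
    (MvPolynomial.isHomogeneous_C (Fin n) (t i j))

lemma coeff_quadForm_pow_eq_zero {n : ℕ} (t : Fin n → Fin n → ℂ) {k : Fin n →₀ ℕ} {d : ℕ}
    (hd : k.degree < d) : MvPolynomial.coeff k (quadForm t ^ d) = 0 :=
  ((quadForm_isHomogeneous t).pow d).coeff_eq_zero (by omega)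

lemma coeff_expSeries {n : ℕ} (t : Fin n → Fin n → ℂ) {k : Fin n →₀ ℕ} {D : ℕ}
    (hD : k.degree < D) :
    MvPowerSeries.coeff k (expSeries t)
      = ∑ d ∈ Finset.range D, (d ! : ℂ)⁻¹ * MvPolynomial.coeff k (quadForm t ^ d) := by
  have hcoe : (∑ i : Fin n, ∑ j ∈ Finset.Ioi i,
      MvPowerSeries.X i * MvPowerSeries.X j * MvPowerSeries.C (t i j) : MvPowerSeries (Fin n) ℂ)
      = (quadForm t : MvPowerSeries (Fin n) ℂ) := by
    simp only [quadForm, ← MvPolynomial.coeToMvPowerSeries.ringHom_apply, map_sum, map_mul]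
    simp
  have hsubst : PowerSeries.HasSubst (quadForm t : MvPowerSeries (Fin n) ℂ) := by
    apply PowerSeries.HasSubst.of_constantCoeff_zero
    rw [← hcoe]
    simp
  have hterm : ∀ d, PowerSeries.coeff d (PowerSeries.exp ℂ) •
      MvPowerSeries.coeff k ((quadForm t : MvPowerSeries (Fin n) ℂ) ^ d)
      = (d ! : ℂ)⁻¹ * MvPolynomial.coeff k (quadForm t ^ d) := fun d => by
    rw [PowerSeries.coeff_exp, ← MvPolynomial.coe_pow, MvPolynomial.coeff_coe]
    simp
  rw [expSeries, hcoe, PowerSeries.coeff_subst hsubst, finsum_congr hterm]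
  refine finsum_eq_sum_of_support_subset _ fun d hd => ?_
  by_contra hdD
  refine hd ?_
  beta_reduce
  rw [coeff_quadForm_pow_eq_zero t (hD.trans_le (by simpa using hdD)), mul_zero]

lemma genCoeff_eq_sum_range {n : ℕ} (t : Fin n → Fin n → ℂ) (k : Fin n →₀ ℕ)
    (Q : MvPolynomial (Fin n) ℂ) {D : ℕ} (hD : k.degree < D) :
    genCoeff t k Q
      = ∑ d ∈ Finset.range D, (d ! : ℂ)⁻¹ * MvPolynomial.coeff k (quadForm t ^ d * Q) := by
  classical
  have h : ∀ a ∈ Finset.HasAntidiagonal.antidiagonal k, MvPowerSeries.coeff a.1 (expSeries t) =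
      ∑ d ∈ Finset.range D, (d ! : ℂ)⁻¹ * MvPolynomial.coeff a.1 (quadForm t ^ d) := by
    intro a ha
    refine coeff_expSeries t (lt_of_le_of_lt ?_ hD)
    rw [← Finset.HasAntidiagonal.mem_antidiagonal.1 ha, map_add]
    exact Nat.le_add_right _ _
  simp only [genCoeff, LinearMap.comp_apply, LinearMap.mulLeft_apply, AlgHom.toLinearMap_apply,
    MvPolynomial.coeToMvPowerSeries.algHom_apply, Algebra.algebraMap_self, MvPowerSeries.map_id,
    RingHom.id_apply, MvPowerSeries.coeff_mul, MvPolynomial.coeff_coe, MvPolynomial.coeff_mul,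
    Finset.mul_sum]
  rw [Finset.sum_comm]
  refine Finset.sum_congr rfl fun a ha => ?_
  simp only [h a ha, Finset.sum_mul, mul_assoc]

lemma finSuccEquiv_C {R : Type*} [CommSemiring R] (n : ℕ) (c : R) :
    MvPolynomial.finSuccEquiv R n (MvPolynomial.C c) = Polynomial.C (MvPolynomial.C c) := by
  simp [MvPolynomial.finSuccEquiv_apply]

lemma finSuccEquiv_linForm {R : Type*} [CommSemiring R] {n : ℕ} (c : Fin (n + 1) → R) :
    MvPolynomial.finSuccEquiv R n (linForm c)
      = Polynomial.X * Polynomial.C (MvPolynomial.C (c 0))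
        + Polynomial.C (linForm fun a => c a.succ) := by
  simp only [linForm, Fin.sum_univ_succ, map_add, map_sum, map_mul, finSuccEquiv_C,
    MvPolynomial.finSuccEquiv_X_zero, MvPolynomial.finSuccEquiv_X_succ]

lemma finSuccEquiv_quadForm {n : ℕ} (t : Fin (n + 1) → Fin (n + 1) → ℂ) :
    MvPolynomial.finSuccEquiv ℂ n (quadForm t)
      = Polynomial.X * Polynomial.C (linForm fun a => t 0 a.succ)
        + Polynomial.C (quadForm fun a b => t a.succ b.succ) := by
  have hIoi_zero : Finset.Ioi (0 : Fin (n + 1)) = Finset.univ.map (Fin.succEmb n) := by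
    ext i; simp [Fin.exists_succ_eq]
  have hIoi_succ : ∀ i : Fin n, Finset.Ioi i.succ = (Finset.Ioi i).map (Fin.succEmb n) := by
    intro i; simp
  simp only [quadForm, linForm, Fin.sum_univ_succ, map_add, map_sum, map_mul, hIoi_zero, hIoi_succ,
    Finset.sum_map, Fin.coe_succEmb, MvPolynomial.finSuccEquiv_X_zero,
    MvPolynomial.finSuccEquiv_X_succ, finSuccEquiv_C, Finset.mul_sum, mul_assoc]

lemma inv_factorial_mul_add_pow {K A : Type*} [Field K] [CharZero K] [CommSemiring A]
    [Algebra K A] (x y : A) (d : ℕ) :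
    (d ! : K)⁻¹ • (x + y) ^ d
      = ∑ p ∈ Finset.range (d + 1), ((p ! : K)⁻¹ * ((d - p)! : K)⁻¹) • (x ^ p * y ^ (d - p)) := by
  rw [add_pow, Finset.smul_sum]
  refine Finset.sum_congr rfl fun p hp => ?_
  have hchoose : (d ! : K)⁻¹ * (d.choose p : K) = (p ! : K)⁻¹ * ((d - p)! : K)⁻¹ := by
    rw [Nat.cast_choose K (Finset.mem_range_succ_iff.1 hp)]
    have : (d ! : K) ≠ 0 := by exact_mod_cast d.factorial_ne_zero
    field_simp
  rw [← hchoose, mul_smul, Nat.cast_smul_eq_nsmul, nsmul_eq_mul, mul_comm (x ^ p * y ^ (d - p))]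

lemma coeff_cons_quadForm_pow_mul {n : ℕ} (t : Fin (n + 1) → Fin (n + 1) → ℂ) (l : ℕ)
    (k : Fin n →₀ ℕ) (Q : MvPolynomial (Fin (n + 1)) ℂ) (d : ℕ) :
    (d ! : ℂ)⁻¹ * MvPolynomial.coeff (k.cons l) (quadForm t ^ d * Q)
      = ∑ p ∈ Finset.range (d + 1), if p ≤ l then (p ! : ℂ)⁻¹ * (((d - p)! : ℂ)⁻¹ *
          MvPolynomial.coeff k ((quadForm fun a b => t a.succ b.succ) ^ (d - p) *
            ((linForm fun a => t 0 a.succ) ^ p *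
              (MvPolynomial.finSuccEquiv ℂ n Q).coeff (l - p)))) else 0 := by
  rw [← smul_eq_mul, ← MvPolynomial.coeff_smul, ← MvPolynomial.finSuccEquiv_coeff_coeff,
    ← smul_mul_assoc, map_mul, map_smul, map_pow, finSuccEquiv_quadForm,
    inv_factorial_mul_add_pow, Finset.sum_mul, Polynomial.finsetSum_coeff, MvPolynomial.coeff_sum]
  refine Finset.sum_congr rfl fun p _ => ?_
  rw [smul_mul_assoc, Polynomial.coeff_smul, MvPolynomial.coeff_smul, mul_pow, ← map_pow,
    ← map_pow, mul_assoc, mul_assoc, Polynomial.coeff_X_pow_mul']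
  split_ifs with hp
  · rw [Polynomial.coeff_C_mul, Polynomial.coeff_C_mul, smul_eq_mul, mul_assoc,
      mul_left_comm (_ ^ p)]
  · simp

lemma genCoeff_cons {n : ℕ} (t : Fin (n + 1) → Fin (n + 1) → ℂ) (l : ℕ) (k : Fin n →₀ ℕ)
    (Q : MvPolynomial (Fin (n + 1)) ℂ) :
    genCoeff t (k.cons l) Q = ∑ p ∈ Finset.range (l + 1), (p ! : ℂ)⁻¹ *
      genCoeff (fun a b => t a.succ b.succ) k
        ((linForm fun a => t 0 a.succ) ^ p *
          (MvPolynomial.finSuccEquiv ℂ n Q).coeff (l - p)) := by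
  have hdeg : (k.cons l).degree = l + k.degree := by
    simp [Finsupp.degree_eq_sum, Fin.sum_univ_succ]
  rw [genCoeff_eq_sum_range _ _ _ (D := l + k.degree + 1) (by omega)]
  simp only [coeff_cons_quadForm_pow_mul]
  rw [Finset.sum_range_diag_flip (l + k.degree + 1) fun p q => if p ≤ l then (p ! : ℂ)⁻¹ *
    ((q ! : ℂ)⁻¹ * MvPolynomial.coeff k ((quadForm fun a b => t a.succ b.succ) ^ q *
      ((linForm fun a => t 0 a.succ) ^ p *
        (MvPolynomial.finSuccEquiv ℂ n Q).coeff (l - p)))) else 0]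
  symm
  refine Finset.sum_subset_zero_on_sdiff (Finset.range_subset_range.2 (by omega)) ?_ ?_
  · intro p hp
    simp_all
  · intro p hp
    have hp' : p ≤ l := Finset.mem_range_succ_iff.1 hp
    rw [genCoeff_eq_sum_range _ _ _ (D := l + k.degree + 1 - p) (by omega), Finset.mul_sum]
    simp only [if_pos hp']

lemma coeff_finSuccEquiv_prod_linForm {R ι : Type*} [CommSemiring R] [Fintype ι] [DecidableEq ι]
    {n : ℕ} (c : ι → Fin (n + 1) → R) (q : ℕ) :
    (MvPolynomial.finSuccEquiv R n (∏ r, linForm (c r))).coeff q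
      = ∑ S ∈ Finset.powersetCard q Finset.univ, MvPolynomial.C (∏ r ∈ S, c r 0) *
          ∏ r ∈ Sᶜ, linForm fun a => c r a.succ := by
  simp only [map_prod, finSuccEquiv_linForm]
  rw [Fintype.prod_add, Polynomial.finsetSum_coeff, ← Finset.powerset_univ,
    Finset.powersetCard_eq_filter, Finset.sum_filter]
  refine Finset.sum_congr rfl fun S _ => ?_
  rw [Finset.prod_mul_distrib, Finset.prod_const, ← map_prod Polynomial.C,
    ← map_prod Polynomial.C, mul_assoc, ← Polynomial.C_mul, Polynomial.coeff_X_pow_mul',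
    Polynomial.coeff_C]
  grind

/-! ### Kinematic estimates -/

lemma continuous_energy (m : ℝ) : Continuous (energy m) := by
  unfold energy; fun_prop

lemma energy_nonneg (m : ℝ) (p : Momentum) : 0 ≤ energy m p := Real.sqrt_nonneg _

lemma norm_le_energy (m : ℝ) (p : Momentum) : ‖p‖ ≤ energy m p :=
  Real.le_sqrt_of_sq_le (by nlinarith [sq_nonneg m])

lemma onShell_zero_coord (m : ℝ) (p : Momentum) : onShell m p 0 = energy m p := rfl

lemma continuous_onShell (m : ℝ) : Continuous (onShell m) := by
  have := continuous_energy m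
  have h : Continuous fun p => ![energy m p, p 0, p 1, p 2] := by
    simp only [continuous_pi_iff, Fin.forall_fin_succ, Matrix.cons_val_zero, Matrix.cons_val_succ]
    exact ⟨this, by fun_prop, by fun_prop, by fun_prop, fun i => i.elim0⟩
  exact (PiLp.continuous_toLp 2 _).comp h

lemma norm_onShell_le (m : ℝ) (p : Momentum) : ‖onShell m p‖ ≤ 2 * ‖p‖ + |m| := by
  refine le_of_sq_le_sq ?_ (by positivity)
  have hp : ‖p‖ ^ 2 = p 0 ^ 2 + p 1 ^ 2 + p 2 ^ 2 := by
    simp [EuclideanSpace.norm_sq_eq, Fin.sum_univ_three]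
  have hE : energy m p ^ 2 = ‖p‖ ^ 2 + m ^ 2 := Real.sq_sqrt (by positivity)
  have hnorm : ‖onShell m p‖ ^ 2 = 2 * ‖p‖ ^ 2 + m ^ 2 := by
    rw [EuclideanSpace.norm_sq_eq, Fin.sum_univ_four]
    simp [onShell]
    linarith
  nlinarith [sq_abs m, mul_nonneg (abs_nonneg m) (norm_nonneg p)]

lemma one_add_norm_onShell_le (m : ℝ) (p : Momentum) :
    1 + ‖onShell m p‖ ≤ (2 + |m|) * (1 + ‖p‖) := by
  nlinarith [norm_onShell_le m p, mul_nonneg (abs_nonneg m) (norm_nonneg p)]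

lemma norm_le_norm_sum_onShell (m : ℝ) {ι : Type*} (S : Finset ι) (ξ : ι → Momentum) {k : ι}
    (hk : k ∈ S) : ‖ξ k‖ ≤ ‖∑ k ∈ S, onShell m (ξ k)‖ :=
  calc ‖ξ k‖ ≤ energy m (ξ k) := norm_le_energy m (ξ k)
    _ ≤ ∑ k ∈ S, energy m (ξ k) :=
        Finset.single_le_sum (f := fun k => energy m (ξ k)) (fun k _ => energy_nonneg m _) hk
    _ = (∑ k ∈ S, onShell m (ξ k)) 0 := by simp [onShell_zero_coord]
    _ ≤ ‖∑ k ∈ S, onShell m (ξ k)‖ :=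
        (le_abs_self _).trans (PiLp.norm_apply_le (∑ k ∈ S, onShell m (ξ k)) 0)

lemma mink_sub_left (p q x : Spacetime) : mink (p - q) x = mink p x - mink q x := by
  simp [mink]; ring

lemma mink_sub_right (p x y : Spacetime) : mink p (x - y) = mink p x - mink p y := by
  simp [mink]; ring

lemma mink_sum_left {ι : Type*} (S : Finset ι) (p : ι → Spacetime) (x : Spacetime) :
    mink (∑ i ∈ S, p i) x = ∑ i ∈ S, mink (p i) x := by
  simp [mink, Finset.sum_mul]

lemma continuous_mink_comp {X : Type*} [TopologicalSpace X] {p x : X → Spacetime}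
    (hp : Continuous p) (hx : Continuous x) : Continuous fun z => mink (p z) (x z) := by
  unfold mink; fun_prop

/-! ### The Fourier transform -/

/-- The Euclidean covector `(p⁰, -p¹, -p², -p³) / 2π`, at which Mathlib's Fourier transform has the
phase `e^{-ip·x}`. -/
def freq (p : Spacetime) : Spacetime :=
  (2 * Real.pi)⁻¹ • !₂[p 0, -p 1, -p 2, -p 3]

lemma norm_freq (p : Spacetime) : ‖freq p‖ = (2 * Real.pi)⁻¹ * ‖p‖ := by
  rw [freq, norm_smul, Real.norm_of_nonneg (by positivity)]
  congr 1
  rw [EuclideanSpace.norm_eq, EuclideanSpace.norm_eq, Fin.sum_univ_four, Fin.sum_univ_four]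
  simp

lemma continuous_freq : Continuous freq := by
  have h : Continuous fun p : Spacetime => ![p 0, -p 1, -p 2, -p 3] := by
    simp only [continuous_pi_iff, Fin.forall_fin_succ, Matrix.cons_val_zero, Matrix.cons_val_succ]
    exact ⟨by fun_prop, by fun_prop, by fun_prop, by fun_prop, fun i => i.elim0⟩
  exact ((PiLp.continuous_toLp 2 _).comp h).const_smul ((2 * Real.pi)⁻¹ : ℝ)

lemma two_pi_mul_inner_freq (p x : Spacetime) :
    2 * Real.pi * inner ℝ x (freq p) = mink p x := by
  simp [freq, mink, PiLp.inner_apply, Fin.sum_univ_four]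
  field_simp
  ring

lemma ftilde_eq_fourier (f : 𝓢(Spacetime, ℂ)) (p : Spacetime) :
    ftilde f p = ((2 * Real.pi : ℝ) : ℂ)⁻¹ ^ 2 *
      (FourierTransform.fourier f : 𝓢(Spacetime, ℂ)) (freq p) := by
  rw [ftilde, SchwartzMap.fourier_coe, Real.fourier_eq']
  simp only [neg_mul, two_pi_mul_inner_freq, smul_eq_mul]
  congr! 5 with x
  push_cast
  ring

lemma continuous_ftilde (f : 𝓢(Spacetime, ℂ)) : Continuous (ftilde f) := by
  rw [funext (ftilde_eq_fourier f)]
  exact continuous_const.mul ((SchwartzMap.continuous _).comp continuous_freq)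

lemma ftilde_decay (f : 𝓢(Spacetime, ℂ)) (r : ℕ) :
    ∃ C, ∀ p, (1 + ‖p‖) ^ r * ‖ftilde f p‖ ≤ C := by
  obtain ⟨C, hC⟩ : ∃ C, ∀ w, (1 + ‖w‖) ^ r *
      ‖(FourierTransform.fourier f : 𝓢(Spacetime, ℂ)) w‖ ≤ C := by
    have h := fun w => SchwartzMap.one_add_le_sup_seminorm_apply (𝕜 := ℂ) (m := (r, 0)) le_rfl
      le_rfl (FourierTransform.fourier f : 𝓢(Spacetime, ℂ)) w
    simp only [norm_iteratedFDeriv_zero] at h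
    exact ⟨_, h⟩
  refine ⟨(2 * Real.pi) ^ r * (‖((2 * Real.pi : ℝ) : ℂ)⁻¹ ^ 2‖ * C), fun p => ?_⟩
  have hfreq : 1 + ‖p‖ ≤ 2 * Real.pi * (1 + ‖freq p‖) := by
    rw [norm_freq, mul_add, ← mul_assoc, mul_inv_cancel₀ (by positivity), one_mul]
    nlinarith [Real.pi_gt_three]
  calc (1 + ‖p‖) ^ r * ‖ftilde f p‖
      ≤ (2 * Real.pi * (1 + ‖freq p‖)) ^ r * ‖ftilde f p‖ := by gcongr
    _ = (2 * Real.pi) ^ r * (‖((2 * Real.pi : ℝ) : ℂ)⁻¹ ^ 2‖ * ((1 + ‖freq p‖) ^ r *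
          ‖(FourierTransform.fourier f : 𝓢(Spacetime, ℂ)) (freq p)‖)) := by
        rw [ftilde_eq_fourier, norm_mul, mul_pow]; ring
    _ ≤ _ := by gcongr; exact hC _

/-! ### Integration over the mass hyperboloid -/

lemma measurable_density (m : ℝ) : Measurable fun p => ENNReal.ofReal (1 / energy m p) :=
  (measurable_const.div (continuous_energy m).measurable).ennreal_ofReal

lemma integrable_inv_norm_mul_inv_one_add_norm_pow :
    Integrable fun p : Momentum => ‖p‖⁻¹ * ((1 + ‖p‖) ^ 4)⁻¹ := by
  rw [integrable_fun_norm_addHaar (μ := volume) (f := fun y : ℝ => y⁻¹ * ((1 + y) ^ 4)⁻¹)]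
  refine Integrable.mono' (integrable_one_add_norm (E := ℝ) (r := 3) (by simp)).integrableOn
    (Measurable.aestronglyMeasurable (by fun_prop)) ?_
  filter_upwards [ae_restrict_mem measurableSet_Ioi] with y hy
  replace hy : 0 < y := hy
  rw [finrank_euclideanSpace, Fintype.card_fin, smul_eq_mul, Real.norm_of_nonneg (by positivity),
    Real.norm_of_nonneg hy.le, Real.rpow_neg (by positivity)]
  norm_cast
  field_simp
  norm_num
  nlinarith

lemma integrable_Omega_inv_one_add_norm_pow (m : ℝ) :
    Integrable (fun p => ((1 + ‖p‖) ^ 4)⁻¹) (Omega m) := by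
  rw [Omega, integrable_withDensity_iff_integrable_smul' (measurable_density m)
    (ae_of_all _ fun _ => ENNReal.ofReal_lt_top)]
  refine integrable_inv_norm_mul_inv_one_add_norm_pow.mono'
    ((measurable_density m).ennreal_toReal.smul (by fun_prop)).aestronglyMeasurable ?_
  filter_upwards [compl_mem_ae_iff.2 (measure_singleton (0 : Momentum))] with p hp
  have hE := energy_nonneg m p
  rw [norm_smul, ENNReal.toReal_ofReal (by positivity), Real.norm_of_nonneg (by positivity),
    Real.norm_of_nonneg (by positivity), one_div]
  have := norm_pos_iff.2 hp
  gcongr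
  exact norm_le_energy m p

lemma integrable_Omega_of_bound {E : Type*} [NormedAddCommGroup E] {m : ℝ} {g : Momentum → E}
    (hg : AEStronglyMeasurable g (Omega m)) {C : ℝ} (h : ∀ p, (1 + ‖p‖) ^ 4 * ‖g p‖ ≤ C) :
    Integrable g (Omega m) := by
  refine ((integrable_Omega_inv_one_add_norm_pow m).const_mul C).mono' hg (ae_of_all _ fun p => ?_)
  rw [← div_eq_mul_inv, le_div_iff₀ (by positivity), mul_comm]
  exact h p

lemma exists_one_add_pow_mul_exp_neg_le (n : ℕ) {δ : ℝ} (hδ : 0 < δ) :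
    ∃ C, ∀ x : ℝ, 0 ≤ x → (1 + x) ^ n * Real.exp (-(δ * x)) ≤ C := by
  refine ⟨n ! / δ ^ n * Real.exp δ, fun x hx => ?_⟩
  have h := Real.pow_div_factorial_le_exp (δ * (1 + x)) (by positivity) n
  calc (1 + x) ^ n * Real.exp (-(δ * x))
      = n ! / δ ^ n * ((δ * (1 + x)) ^ n / n ! * Real.exp (-(δ * x))) := by
        rw [mul_pow]; field_simp
    _ ≤ n ! / δ ^ n * (Real.exp (δ * (1 + x)) * Real.exp (-(δ * x))) := by gcongr
    _ = n ! / δ ^ n * Real.exp δ := by rw [← Real.exp_add]; ring_nf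

lemma integrable_exp_neg_energy (m : ℝ) {δ : ℝ} (hδ : 0 < δ) :
    Integrable (fun p => Real.exp (-(δ * energy m p))) (Omega m) := by
  obtain ⟨C, hC⟩ := exists_one_add_pow_mul_exp_neg_le 4 hδ
  have := continuous_energy m
  refine integrable_Omega_of_bound (C := C) (Continuous.aestronglyMeasurable (by fun_prop))
    fun p => le_trans ?_ (hC ‖p‖ (norm_nonneg p))
  rw [Real.norm_of_nonneg (Real.exp_pos _).le]
  gcongr
  exact norm_le_energy m p

lemma integral_Omega (m : ℝ) (g : Momentum → ℂ) :
    ∫ p, g p ∂(Omega m) = ∫ p, ((energy m p : ℝ) : ℂ)⁻¹ * g p := by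
  rw [Omega, integral_withDensity_eq_integral_toReal_smul (measurable_density m)
    (ae_of_all _ fun _ => ENNReal.ofReal_lt_top)]
  refine integral_congr_ae (ae_of_all _ fun p => ?_)
  have := energy_nonneg m p
  beta_reduce
  rw [ENNReal.toReal_ofReal (by positivity), Complex.real_smul, one_div, Complex.ofReal_inv]

/-- The weight `∏ (1 + |ζ_i|)`, whose powers measure the decay of wave functions. -/
def weight {ι : Type*} [Fintype ι] (ζ : ι → Momentum) : ℝ := ∏ i, (1 + ‖ζ i‖)

lemma one_le_weight {ι : Type*} [Fintype ι] (ζ : ι → Momentum) : 1 ≤ weight ζ :=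
  Finset.one_le_prod fun i => by simp

lemma weight_pos {ι : Type*} [Fintype ι] (ζ : ι → Momentum) : 0 < weight ζ :=
  zero_lt_one.trans_le (one_le_weight ζ)

lemma weight_append {j q : ℕ} (η : Fin j → Momentum) (ξ : Fin q → Momentum) :
    weight (Fin.append η ξ) = weight η * weight ξ := by
  simp [weight, Fin.prod_univ_add]

lemma prod_orderEmbOfFin {α M : Type*} [LinearOrder α] [CommMonoid M] (s : Finset α) (F : α → M) :
    ∏ r, F (s.orderEmbOfFin rfl r) = ∏ i ∈ s, F i := by
  conv_rhs => rw [← s.map_orderEmbOfFin_univ rfl, Finset.prod_map]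
  rfl

lemma weight_eq_mul {N : ℕ} (ξ : Fin N → Momentum) (S : Finset (Fin N)) :
    weight ξ = (∏ k ∈ S, (1 + ‖ξ k‖)) * weight (ξ ∘ Sᶜ.orderEmbOfFin rfl) := by
  rw [weight, ← Finset.prod_mul_prod_compl S, weight]
  exact congrArg _ (prod_orderEmbOfFin Sᶜ fun k => 1 + ‖ξ k‖).symm

lemma integrable_inv_weight_pow (m : ℝ) (ι : Type) [Fintype ι] :
    Integrable (fun ζ => (weight ζ ^ 4)⁻¹) (OmegaPi m ι) := by
  simpa only [weight, ← Finset.prod_pow, Finset.prod_inv_distrib] using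
    Integrable.fintype_prod fun _ : ι => integrable_Omega_inv_one_add_norm_pow m

/-! ### Rapidly decreasing families of states -/

/-- Sequences `(Φ^{(M)})_M` of everywhere defined wave functions, one for each particle number. -/
abbrev WaveFunctions : Type := (M : ℕ) → (Fin M → Momentum) → ℂ

/-- The functions `F a` of finitely many momenta decrease faster than any power of the weight,
uniformly in the parameter `a`. -/
def UniformRapidDecay {A ι : Type*} [Fintype ι] (F : A → (ι → Momentum) → ℂ) : Prop :=
  ∀ r : ℕ, ∃ C, ∀ a ζ, weight ζ ^ r * ‖F a ζ‖ ≤ C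

namespace UniformRapidDecay

variable {A ι : Type*} [Fintype ι] {F G : A → (ι → Momentum) → ℂ}

lemma mono (hG : UniformRapidDecay G) (h : ∀ a ζ, ‖F a ζ‖ ≤ ‖G a ζ‖) : UniformRapidDecay F :=
  fun r => (hG r).imp fun _ hC a ζ =>
    (mul_le_mul_of_nonneg_left (h a ζ) (pow_pos (weight_pos ζ) r).le).trans (hC a ζ)

lemma const_mul (hF : UniformRapidDecay F) (c : ℂ) : UniformRapidDecay fun a ζ => c * F a ζ := by
  intro r
  obtain ⟨C, hC⟩ := hF r
  refine ⟨‖c‖ * C, fun a ζ => ?_⟩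
  rw [norm_mul, mul_left_comm]
  gcongr
  exact hC a ζ

lemma sum {κ : Type*} {s : Finset κ} {F : κ → A → (ι → Momentum) → ℂ}
    (hF : ∀ i ∈ s, UniformRapidDecay (F i)) : UniformRapidDecay fun a ζ => ∑ i ∈ s, F i a ζ := by
  intro r
  choose! C hC using fun i hi => hF i hi r
  refine ⟨∑ i ∈ s, C i, fun a ζ => ?_⟩
  have := (pow_pos (weight_pos ζ) r).le
  calc weight ζ ^ r * ‖∑ i ∈ s, F i a ζ‖
      ≤ weight ζ ^ r * ∑ i ∈ s, ‖F i a ζ‖ := by gcongr; exact norm_sum_le _ _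
    _ = ∑ i ∈ s, weight ζ ^ r * ‖F i a ζ‖ := Finset.mul_sum _ _ _
    _ ≤ ∑ i ∈ s, C i := Finset.sum_le_sum fun i hi => hC i hi a ζ

end UniformRapidDecay

/-- A family of states with a bounded number of particles, whose wave functions are symmetric,
jointly continuous, and rapidly decreasing uniformly in the parameter. Every Wick power maps such
families to such families. -/
structure RapidFamily {A : Type*} [TopologicalSpace A] (Φ : A → WaveFunctions) : Prop where
  finite : ∃ M₀, ∀ a, ∀ M > M₀, ∀ ζ, Φ a M ζ = 0
  cont : ∀ M, Continuous fun q : A × (Fin M → Momentum) => Φ q.1 M q.2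
  decay : ∀ M, UniformRapidDecay fun a => Φ a M
  symm : ∀ a M (σ : Equiv.Perm (Fin M)) ζ, Φ a M (ζ ∘ σ) = Φ a M ζ

/-- The wave functions of the vacuum. -/
def vacFn : WaveFunctions := fun M _ => if M = 0 then 1 else 0

/-- The wave functions of `e^{-|s|H} Φ`, where `H` is the energy. -/
def damp (m s : ℝ) (Φ : WaveFunctions) : WaveFunctions := fun _ ζ =>
  (Real.exp (-(|s| * ∑ i, energy m (ζ i))) : ℂ) * Φ _ ζ

lemma norm_damp_le (m s : ℝ) (Φ : WaveFunctions) (M : ℕ) (ζ : Fin M → Momentum) :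
    ‖damp m s Φ M ζ‖ ≤ ‖Φ M ζ‖ := by
  have h : 0 ≤ |s| * ∑ i, energy m (ζ i) :=
    mul_nonneg (abs_nonneg _) (Finset.sum_nonneg fun i _ => energy_nonneg m _)
  rw [damp, norm_mul, Complex.norm_real, Real.norm_of_nonneg (Real.exp_pos _).le]
  exact mul_le_of_le_one_left (norm_nonneg _) (Real.exp_le_one_iff.2 (by linarith))

lemma one_add_norm_sum_le_prod {E ι : Type*} [SeminormedAddCommGroup E] (T : Finset ι)
    (v : ι → E) : 1 + ‖∑ i ∈ T, v i‖ ≤ ∏ i ∈ T, (1 + ‖v i‖) := by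
  classical
  induction T using Finset.induction_on with
  | empty => simp
  | insert a T ha ih =>
    rw [Finset.sum_insert ha, Finset.prod_insert ha]
    nlinarith [norm_add_le (v a) (∑ i ∈ T, v i), norm_nonneg (v a), norm_nonneg (∑ i ∈ T, v i)]

lemma one_add_norm_le_mul_sub {E : Type*} [SeminormedAddCommGroup E] (P Q : E) :
    1 + ‖Q‖ ≤ (1 + ‖P - Q‖) * (1 + ‖P‖) := by
  have h : ‖Q‖ ≤ ‖P - Q‖ + ‖P‖ := by
    simpa [norm_sub_rev, add_comm] using norm_le_norm_add_norm_sub P Q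
  nlinarith [norm_nonneg (P - Q), norm_nonneg P]

lemma one_add_norm_sum_onShell_le (m : ℝ) {ι : Type*} [Fintype ι] (η : ι → Momentum) :
    1 + ‖∑ r, onShell m (η r)‖ ≤ (2 + |m|) ^ Fintype.card ι * weight η :=
  calc 1 + ‖∑ r, onShell m (η r)‖ ≤ ∏ r, (1 + ‖onShell m (η r)‖) :=
        one_add_norm_sum_le_prod Finset.univ _
    _ ≤ ∏ r, (2 + |m|) * (1 + ‖η r‖) :=
        Finset.prod_le_prod (fun _ _ => by positivity) fun r _ => one_add_norm_onShell_le m (η r)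
    _ = (2 + |m|) ^ Fintype.card ι * weight η := by
        simp [Finset.prod_mul_distrib, weight]

/-- The total energy of the created particles bounds each of their momenta, so that the decay of
`ftilde` in the momentum transfer controls them by the absorbed momenta. -/
lemma prod_one_add_norm_le (m : ℝ) {N j : ℕ} (ξ : Fin N → Momentum) (S : Finset (Fin N))
    (η : Fin j → Momentum) :
    ∏ k ∈ S, (1 + ‖ξ k‖) ≤
      ((1 + ‖∑ r, onShell m (η r) - ∑ k ∈ S, onShell m (ξ k)‖) *
        ((2 + |m|) ^ j * weight η)) ^ S.card := by
  rw [← Finset.prod_const]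
  refine Finset.prod_le_prod (fun _ _ => by positivity) fun k hk => ?_
  calc 1 + ‖ξ k‖ ≤ 1 + ‖∑ k ∈ S, onShell m (ξ k)‖ := by
        gcongr
        exact norm_le_norm_sum_onShell m S ξ hk
    _ ≤ _ := one_add_norm_le_mul_sub (∑ r, onShell m (η r)) _
    _ ≤ _ := by
        gcongr
        simpa using one_add_norm_sum_onShell_le m η

lemma weight_pow_le (m : ℝ) {N j : ℕ} (ξ : Fin N → Momentum) (S : Finset (Fin N))
    (η : Fin j → Momentum) (r : ℕ) :
    weight ξ ^ r ≤ ((1 + ‖∑ r, onShell m (η r) - ∑ k ∈ S, onShell m (ξ k)‖) *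
        ((2 + |m|) ^ j * weight η)) ^ (S.card * r) * weight (ξ ∘ Sᶜ.orderEmbOfFin rfl) ^ r := by
  rw [weight_eq_mul ξ S, mul_pow, pow_mul]
  have := weight_pos (ξ ∘ Sᶜ.orderEmbOfFin rfl)
  have : 0 ≤ ∏ k ∈ S, (1 + ‖ξ k‖) := Finset.prod_nonneg fun _ _ => by positivity
  gcongr
  exact prod_one_add_norm_le m ξ S η

lemma continuous_append {X E : Type*} [TopologicalSpace X] [TopologicalSpace E] {j q : ℕ}
    {g : X → Fin j → E} {h : X → Fin q → E} (hg : Continuous g) (hh : Continuous h) :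
    Continuous fun x => Fin.append (g x) (h x) := by
  refine continuous_pi fun i => ?_
  refine Fin.addCases (fun i => ?_) (fun i => ?_) i
  · simpa [Function.comp_def] using (continuous_apply i).comp hg
  · simpa [Function.comp_def] using (continuous_apply i).comp hh

lemma wickValue_eq_zero {m : ℝ} {l : ℕ} {f : 𝓢(Spacetime, ℂ)} {Φ : WaveFunctions} {M₀ : ℕ}
    (hΦ : ∀ M > M₀, ∀ ζ, Φ M ζ = 0) {N : ℕ} (hN : M₀ + l < N) (ξ : Fin N → Momentum) :
    wickValue m l f Φ N ξ = 0 := by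
  refine mul_eq_zero_of_right _ (Finset.sum_eq_zero fun j _ =>
    mul_eq_zero_of_right _ (Finset.sum_eq_zero fun S hS => ?_))
  have hScard : S.card = l - j := (Finset.mem_powersetCard.1 hS).2
  have hcompl : Sᶜ.card = N - S.card := by rw [Finset.card_compl, Fintype.card_fin]
  have hzero : ∀ η, wickIntegrand m f Φ ξ S j η = 0 := fun η => by
    rw [wickIntegrand, hΦ _ (by omega), mul_zero]
  simp [hzero]

lemma rapidFamily_vacFn {A : Type*} [TopologicalSpace A] : RapidFamily fun _ : A => vacFn where
  finite := ⟨0, fun _ _ hM _ => if_neg (by omega)⟩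
  cont _ := continuous_const
  decay M r := by
    rcases eq_or_ne M 0 with rfl | hM
    · exact ⟨1, fun _ ζ => by simp [vacFn, weight]⟩
    · exact ⟨0, fun _ ζ => by simp [vacFn, hM]⟩
  symm _ _ _ _ := rfl

namespace RapidFamily

variable {A : Type*} [TopologicalSpace A] {Φ : A → WaveFunctions}

lemma comp_continuous {A' : Type*} [TopologicalSpace A'] (h : RapidFamily Φ) {g : A' → A}
    (hg : Continuous g) : RapidFamily fun a => Φ (g a) where
  finite := h.finite.imp fun _ h a => h (g a)
  cont M := (h.cont M).comp ((hg.comp continuous_fst).prodMk continuous_snd)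
  decay M r := (h.decay M r).imp fun _ h a => h (g a)
  symm a := h.symm (g a)

lemma continuous_apply (h : RapidFamily Φ) (a : A) (M : ℕ) : Continuous (Φ a M) :=
  (h.cont M).comp (Continuous.prodMk_right a)

lemma damp (m : ℝ) (h : RapidFamily Φ) {s : A → ℝ} (hs : Continuous s) :
    RapidFamily fun a => damp m (s a) (Φ a) where
  finite := h.finite.imp fun _ h a M hM ζ => by simp [WickExp.damp, h a M hM ζ]
  cont M := by
    have := continuous_energy m
    have := h.cont M
    unfold WickExp.damp
    fun_prop
  decay M := (h.decay M).mono fun a ζ => norm_damp_le m (s a) (Φ a) M ζ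
  symm a M σ ζ := by
    simp only [WickExp.damp, h.symm a M σ ζ, Function.comp_apply]
    rw [Equiv.sum_comp σ fun i => energy m (ζ i)]

lemma apply_eq_of_equiv (h : RapidFamily Φ) (a : A) {M M' : ℕ} (e : Fin M ≃ Fin M')
    (ζ : Fin M → Momentum) (ζ' : Fin M' → Momentum) (hζ : ∀ i, ζ i = ζ' (e i)) :
    Φ a M ζ = Φ a M' ζ' := by
  obtain rfl : M = M' := by simpa using Fintype.card_congr e
  rw [← h.symm a M e ζ']
  exact congrArg _ (funext hζ)

lemma exists_wickIntegrand_bound (h : RapidFamily Φ) (m : ℝ) (f : 𝓢(Spacetime, ℂ)) {N : ℕ}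
    (S : Finset (Fin N)) (j r : ℕ) :
    ∃ C, ∀ a ξ η, weight ξ ^ r * ‖wickIntegrand m f (Φ a) ξ S j η‖ ≤ C * (weight η ^ 4)⁻¹ := by
  obtain ⟨C₁, hC₁⟩ := h.decay (j + Sᶜ.card) (S.card * r + r + 4)
  obtain ⟨C₂, hC₂⟩ := ftilde_decay f (S.card * r)
  refine ⟨((2 + |m|) ^ j) ^ (S.card * r) * (C₂ * C₁), fun a ξ η => ?_⟩
  set p := ∑ r, onShell m (η r) - ∑ k ∈ S, onShell m (ξ k)
  set ξ' := ξ ∘ Sᶜ.orderEmbOfFin rfl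
  have hη := one_le_weight η
  have hξ' := one_le_weight ξ'
  have := weight_pos η
  have := weight_pos ξ'
  rw [← div_eq_mul_inv, le_div_iff₀ (by positivity), wickIntegrand, norm_mul]
  have hweight : weight η ^ (S.card * r + 4) * weight ξ' ^ r
      ≤ weight (Fin.append η ξ') ^ (S.card * r + r + 4) := by
    rw [weight_append, mul_pow]
    gcongr <;> first | assumption | omega
  set F := ‖ftilde f p‖
  set G := ‖Φ a (j + Sᶜ.card) (Fin.append η ξ')‖
  have : 0 ≤ F := norm_nonneg _
  have : 0 ≤ G := norm_nonneg _
  have : 0 ≤ C₂ := le_trans (by positivity) (hC₂ 0)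
  calc weight ξ ^ r * (F * G) * weight η ^ 4
      ≤ ((1 + ‖p‖) * ((2 + |m|) ^ j * weight η)) ^ (S.card * r)
          * weight ξ' ^ r * (F * G) * weight η ^ 4 := by
        gcongr
        exact weight_pow_le m ξ S η r
    _ = ((2 + |m|) ^ j) ^ (S.card * r) * (((1 + ‖p‖) ^ (S.card * r) * F) *
          ((weight η ^ (S.card * r + 4) * weight ξ' ^ r) * G)) := by
        rw [mul_pow, mul_pow, pow_add]; ring
    _ ≤ ((2 + |m|) ^ j) ^ (S.card * r) * (C₂ * C₁) := by
        gcongr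
        · exact hC₂ p
        · exact le_trans (by gcongr) (hC₁ a (Fin.append η ξ'))

lemma continuous_wickIntegrand (h : RapidFamily Φ) (m : ℝ) (f : 𝓢(Spacetime, ℂ)) {N : ℕ}
    (S : Finset (Fin N)) (j : ℕ) :
    Continuous fun q : (A × (Fin N → Momentum)) × (Fin j → Momentum) =>
      wickIntegrand m f (Φ q.1.1) q.1.2 S j q.2 := by
  have := continuous_onShell m
  refine ((continuous_ftilde f).comp (by fun_prop)).mul
    ((h.cont (j + Sᶜ.card)).comp (Continuous.prodMk (by fun_prop) ?_))
  exact continuous_append (by fun_prop)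
    (continuous_pi fun i => (_root_.continuous_apply _).comp (by fun_prop))

lemma integrable_wickIntegrand (h : RapidFamily Φ) (m : ℝ) (f : 𝓢(Spacetime, ℂ)) {N : ℕ}
    (S : Finset (Fin N)) (j : ℕ) (a : A) (ξ : Fin N → Momentum) :
    Integrable (wickIntegrand m f (Φ a) ξ S j) (OmegaPi m (Fin j)) := by
  obtain ⟨C, hC⟩ := h.exists_wickIntegrand_bound m f S j 0
  refine ((integrable_inv_weight_pow m (Fin j)).const_mul C).mono' ?_
    (ae_of_all _ fun η => by simpa using hC a ξ η)
  exact ((h.continuous_wickIntegrand m f S j).comp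
    (Continuous.prodMk_right (a, ξ))).aestronglyMeasurable

lemma wickConverges (h : RapidFamily Φ) (m : ℝ) (l : ℕ) (f : 𝓢(Spacetime, ℂ)) (a : A) (N : ℕ)
    (ξ : Fin N → Momentum) : WickConverges m l f (Φ a) N ξ :=
  fun j _ S _ => h.integrable_wickIntegrand m f S j a ξ

lemma uniformRapidDecay_integral_wickIntegrand (h : RapidFamily Φ) (m : ℝ) (f : 𝓢(Spacetime, ℂ))
    {N : ℕ} (S : Finset (Fin N)) (j : ℕ) :
    UniformRapidDecay fun a (ξ : Fin N → Momentum) =>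
      ∫ η, wickIntegrand m f (Φ a) ξ S j η ∂(OmegaPi m (Fin j)) := by
  intro r
  obtain ⟨C, hC⟩ := h.exists_wickIntegrand_bound m f S j r
  refine ⟨∫ η, C * (weight η ^ 4)⁻¹ ∂(OmegaPi m (Fin j)), fun a ξ => ?_⟩
  calc weight ξ ^ r * ‖∫ η, wickIntegrand m f (Φ a) ξ S j η ∂(OmegaPi m (Fin j))‖
      = ‖∫ η, weight ξ ^ r • wickIntegrand m f (Φ a) ξ S j η ∂(OmegaPi m (Fin j))‖ := by
        rw [integral_smul, norm_smul, Real.norm_of_nonneg (pow_pos (weight_pos ξ) r).le]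
    _ ≤ _ := norm_integral_le_of_norm_le ((integrable_inv_weight_pow m (Fin j)).const_mul C)
        (ae_of_all _ fun η => by
          rw [norm_smul, Real.norm_of_nonneg (pow_pos (weight_pos ξ) r).le]
          exact hC a ξ η)

lemma continuous_integral_wickIntegrand [FirstCountableTopology A] (h : RapidFamily Φ) (m : ℝ)
    (f : 𝓢(Spacetime, ℂ)) {N : ℕ} (S : Finset (Fin N)) (j : ℕ) :
    Continuous fun q : A × (Fin N → Momentum) =>
      ∫ η, wickIntegrand m f (Φ q.1) q.2 S j η ∂(OmegaPi m (Fin j)) := by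
  obtain ⟨C, hC⟩ := h.exists_wickIntegrand_bound m f S j 0
  have hmeas : ∀ q : A × (Fin N → Momentum), AEStronglyMeasurable
      (fun η => wickIntegrand m f (Φ q.1) q.2 S j η) (OmegaPi m (Fin j)) := fun q =>
    (h.integrable_wickIntegrand m f S j q.1 q.2).aestronglyMeasurable
  have hbound : ∀ (q : A × (Fin N → Momentum)) η,
      ‖wickIntegrand m f (Φ q.1) q.2 S j η‖ ≤ C * (weight η ^ 4)⁻¹ := fun q η => by
    simpa only [pow_zero, one_mul] using hC q.1 q.2 η
  have hcont : ∀ η, Continuous fun q : A × (Fin N → Momentum) =>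
      wickIntegrand m f (Φ q.1) q.2 S j η := fun η => by
    have hη : Continuous fun q : A × (Fin N → Momentum) => (q, η) := by fun_prop
    simpa only [Function.comp_def] using (h.continuous_wickIntegrand m f S j).comp hη
  exact continuous_of_dominated hmeas (fun q => ae_of_all _ (hbound q))
    ((integrable_inv_weight_pow m (Fin j)).const_mul C) (ae_of_all _ hcont)

lemma wickIntegrand_comp_perm (h : RapidFamily Φ) (m : ℝ) (f : 𝓢(Spacetime, ℂ)) {N : ℕ}
    (σ : Equiv.Perm (Fin N)) (S : Finset (Fin N)) (j : ℕ) (a : A) (ξ : Fin N → Momentum)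
    (η : Fin j → Momentum) :
    wickIntegrand m f (Φ a) (ξ ∘ σ) S j η
      = wickIntegrand m f (Φ a) ξ (S.map σ.toEmbedding) j η := by
  set S' := S.map σ.toEmbedding
  have hσ : ∀ i, i ∈ Sᶜ ↔ σ i ∈ S'ᶜ := fun i => by simp [S']
  let e : Fin Sᶜ.card ≃ Fin S'ᶜ.card :=
    ((Sᶜ.orderIsoOfFin rfl).toEquiv.trans (σ.subtypeEquiv hσ)).trans
      (S'ᶜ.orderIsoOfFin rfl).symm.toEquiv
  have he : ∀ i, S'ᶜ.orderEmbOfFin rfl (e i) = σ (Sᶜ.orderEmbOfFin rfl i) := fun i =>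
    congrArg Subtype.val (show S'ᶜ.orderIsoOfFin rfl (e i)
      = σ.subtypeEquiv hσ (Sᶜ.orderIsoOfFin rfl i) by simp [e])
  unfold wickIntegrand
  congr 1
  · rw [Finset.sum_map]; rfl
  · refine h.apply_eq_of_equiv a
      (finSumFinEquiv.symm.trans (((Equiv.refl _).sumCongr e).trans finSumFinEquiv)) _ _ fun i => ?_
    refine Fin.addCases (fun i => ?_) (fun i => ?_) i
    · simp
    · simp [he]

lemma wickValue_comp_perm (h : RapidFamily Φ) (m : ℝ) (l : ℕ) (f : 𝓢(Spacetime, ℂ)) (a : A)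
    {N : ℕ} (σ : Equiv.Perm (Fin N)) (ξ : Fin N → Momentum) :
    wickValue m l f (Φ a) N (ξ ∘ σ) = wickValue m l f (Φ a) N ξ := by
  unfold wickValue
  congr! 3 with j
  refine Finset.sum_equiv (Equiv.finsetCongr σ) (fun S => ?_) fun S _ => ?_
  · simp [Finset.mem_powersetCard]
  · simp only [h.wickIntegrand_comp_perm m f σ, Equiv.finsetCongr_apply]

lemma wickValue [FirstCountableTopology A] (h : RapidFamily Φ) (m : ℝ) (l : ℕ)
    (f : 𝓢(Spacetime, ℂ)) : RapidFamily fun a => wickValue m l f (Φ a) where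
  finite := h.finite.imp' (· + l) fun _ hM₀ a _ hM ζ => wickValue_eq_zero (hM₀ a) hM ζ
  cont M := by
    have := fun S j => h.continuous_integral_wickIntegrand m f (N := M) S j
    unfold WickExp.wickValue
    fun_prop
  decay _ := .const_mul (.sum fun j _ => .const_mul (.sum fun S _ =>
    (h.uniformRapidDecay_integral_wickIntegrand m f S j).const_mul _) _) _
  symm a _ σ ζ := h.wickValue_comp_perm m l f a σ ζ

end RapidFamily

/-- The wave functions of
`e^{-|y₁ - b|H} :φ^{k₁}:(f₁) e^{-|y₂ - y₁|H} :φ^{k₂}:(f₂) ⋯ :φ^{k_n}:(f_n) Φ₀`. -/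
def dampedState (m : ℝ) : {n : ℕ} → (Fin n → 𝓢(Spacetime, ℂ)) → (Fin n →₀ ℕ) → (Fin n → ℝ) → ℝ →
    WaveFunctions
  | 0, _, _, _, _ => vacFn
  | _ + 1, f, k, y, b =>
    damp m (y 0 - b) (wickValue m (k 0) (f 0)
      (dampedState m (Fin.tail f) k.tail (Fin.tail y) (y 0)))

lemma rapidFamily_dampedState (m : ℝ) {n : ℕ} (f : Fin n → 𝓢(Spacetime, ℂ)) (k : Fin n →₀ ℕ) :
    RapidFamily fun q : (Fin n → ℝ) × ℝ => dampedState m f k q.1 q.2 := by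
  induction n with
  | zero => exact rapidFamily_vacFn
  | succ n ih =>
    have htail : Continuous fun q : (Fin (n + 1) → ℝ) × ℝ => (Fin.tail q.1, q.1 0) := by
      unfold Fin.tail; fun_prop
    exact (((ih (Fin.tail f) k.tail).comp_continuous htail).wickValue m (k 0) (f 0)).damp m
      (s := fun q : (Fin (n + 1) → ℝ) × ℝ => q.1 0 - q.2) (by fun_prop)

/-! ### Products of Wick powers applied to the vacuum -/

/-- `Φ` is a sequence of representatives of the wave functions of the Fock space vector `Ψ`, which
are only defined up to null sets. -/
def HasWaveFunctions {m : ℝ} (Ψ : Fock m) (Φ : WaveFunctions) : Prop :=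
  ∀ N, ∀ᵐ ξ ∂(OmegaPi m (Fin N)), wave Ψ N ξ = Φ N ξ

lemma hasWaveFunctions_vacuum (m : ℝ) : HasWaveFunctions (vacuum m) vacFn := by
  intro N
  rcases eq_or_ne N 0 with rfl | hN
  · have hvac : (vacuum m) 0 = _ := lp.single_apply_self 2 0 _
    rw [wave, hvac]
    filter_upwards [(memLp_one m).coeFn_toLp] with ξ hξ
    rw [hξ]; rfl
  · have hvac : (vacuum m) N = 0 := lp.single_apply_ne 2 0 _ hN
    rw [wave, hvac]
    filter_upwards [Lp.coeFn_zero ℂ 2 (OmegaPi m (Fin N))] with ξ hξ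
    exact hξ.trans (if_neg hN).symm

lemma HasWaveFunctions.inner_vacuum {m : ℝ} {Ψ : Fock m} {Φ : WaveFunctions}
    (h : HasWaveFunctions Ψ Φ) : inner ℂ (vacuum m) Ψ = Φ 0 ![] := by
  rw [vacuum, lp.inner_single_left, Submodule.coe_inner, L2.inner_def]
  have hinner : ∀ᵐ ξ ∂(OmegaPi m (Fin 0)), inner ℂ
      (((memLp_one m).toLp : Lp ℂ 2 (OmegaPi m (Fin 0))) ξ)
      ((Ψ 0 : Lp ℂ 2 (OmegaPi m (Fin 0))) ξ) = Φ 0 ![] := by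
    filter_upwards [(memLp_one m).coeFn_toLp, h 0] with ξ hone hΨ
    rw [hone, show (Ψ 0 : Lp ℂ 2 (OmegaPi m (Fin 0))) ξ = Φ 0 ξ from hΨ, Subsingleton.elim ξ ![]]
    simp
  rw [integral_congr_ae hinner, OmegaPi, Measure.pi_of_empty _ ![]]
  simp

namespace RapidFamily

variable {A : Type*} [TopologicalSpace A] {Φ : A → WaveFunctions}

lemma memLp (h : RapidFamily Φ) (m : ℝ) (a : A) (N : ℕ) :
    MemLp (Φ a N) 2 (OmegaPi m (Fin N)) := by
  have hcont := h.continuous_apply a N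
  obtain ⟨C, hC⟩ := h.decay N 2
  rw [memLp_two_iff_integrable_sq_norm hcont.aestronglyMeasurable]
  refine ((integrable_inv_weight_pow m (Fin N)).const_mul (C ^ 2)).mono'
    (hcont.norm.pow 2).aestronglyMeasurable (ae_of_all _ fun ζ => ?_)
  have := weight_pos ζ
  rw [Real.norm_of_nonneg (by positivity), ← div_eq_mul_inv, le_div_iff₀ (by positivity)]
  calc ‖Φ a N ζ‖ ^ 2 * weight ζ ^ 4 = (weight ζ ^ 2 * ‖Φ a N ζ‖) ^ 2 := by ring
    _ ≤ C ^ 2 := by gcongr; exact hC a ζ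

lemma exists_hasWaveFunctions (h : RapidFamily Φ) (m : ℝ) (a : A) :
    ∃ Ψ : Fock m, HasWaveFunctions Ψ (Φ a) := by
  let g : (N : ℕ) → symL2 m N := fun N => ⟨(h.memLp m a N).toLp, fun σ => by
    have hrep := (h.memLp m a N).coeFn_toLp
    filter_upwards [hrep, (quasi_comp m σ σ.injective).ae hrep] with ξ hξ hξσ
    rw [hξ, hξσ, h.symm a N σ ξ]⟩
  obtain ⟨M₀, hM₀⟩ := h.finite
  have hg_eq_zero : ∀ N ∉ Finset.range (M₀ + 1), g N = 0 := fun N hN => by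
    refine Subtype.ext (Lp.ext ?_)
    filter_upwards [(h.memLp m a N).coeFn_toLp, Lp.coeFn_zero ℂ 2 (OmegaPi m (Fin N))]
      with ξ hξ hzero
    exact (hξ.trans (hM₀ a N (by simpa [Nat.lt_succ_iff] using hN) ξ)).trans hzero.symm
  have hg : Memℓp g 2 := memℓp_gen <|
    summable_of_ne_finset_zero (s := Finset.range (M₀ + 1)) fun N hN => by simp [hg_eq_zero N hN]
  exact ⟨⟨g, hg⟩, fun N => (h.memLp m a N).coeFn_toLp⟩

lemma mem_graph_wickPower (h : RapidFamily Φ) {m : ℝ} (l : ℕ) (f : 𝓢(Spacetime, ℂ)) (a : A)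
    {Ψ Ψ' : Fock m} (hΨ : HasWaveFunctions Ψ (Φ a))
    (hΨ' : HasWaveFunctions Ψ' (WickExp.wickValue m l f (Φ a))) :
    (Ψ, Ψ') ∈ (wickPower m l f).graph := by
  rw [wickPower, Submodule.toLinearPMap_graph_eq _ (wickGraph_functional m l f)]
  intro N
  filter_upwards [wickIntegrand_ae f hΨ N, hΨ' N] with ξ hwick hval
  obtain ⟨hval_eq, hconv_iff⟩ := wick_congr (l := l) hwick
  exact ⟨hconv_iff.2 (h.wickConverges m l f a N ξ), hval.trans hval_eq.symm⟩

end RapidFamily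

lemma mem_graph_opMul {E : Type*} [AddCommGroup E] [Module ℂ E] {A B : E →ₗ.[ℂ] E} {x y z : E}
    (hB : (x, y) ∈ B.graph) (hA : (y, z) ∈ A.graph) : (x, z) ∈ (opMul A B).graph := by
  rw [LinearPMap.mem_graph_iff] at hA hB ⊢
  obtain ⟨⟨x, hx⟩, rfl, rfl⟩ := hB
  obtain ⟨⟨_, hy⟩, hBx, rfl⟩ := hA
  dsimp only at hBx
  subst hBx
  exact ⟨⟨x, ⟨⟨x, hx⟩, hy, rfl⟩, hx⟩, rfl, rfl⟩

lemma mem_graph_smul {E : Type*} [AddCommGroup E] [Module ℂ E] {A : E →ₗ.[ℂ] E} {x y : E}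
    (c : ℂ) (hA : (x, y) ∈ A.graph) : (x, c • y) ∈ (c • A).graph := by
  rw [LinearPMap.mem_graph_iff] at hA ⊢
  obtain ⟨⟨x, hx⟩, rfl, rfl⟩ := hA
  exact ⟨⟨x, hx⟩, rfl, rfl⟩

lemma wickExpProdCoeff_succ (m : ℝ) {n : ℕ} (f : Fin (n + 1) → 𝓢(Spacetime, ℂ))
    (k : Fin (n + 1) →₀ ℕ) :
    wickExpProdCoeff m f k
      = opMul (wickExpCoeff m (f 0) (k 0)) (wickExpProdCoeff m (Fin.tail f) k.tail) := by
  simp only [wickExpProdCoeff, opProd, List.ofFn_succ, List.foldr_cons]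
  rfl

lemma dampedState_zero_succ (m : ℝ) {n : ℕ} (f : Fin (n + 1) → 𝓢(Spacetime, ℂ))
    (k : Fin (n + 1) →₀ ℕ) :
    dampedState m f k 0 0
      = wickValue m (k 0) (f 0) (dampedState m (Fin.tail f) k.tail 0 0) := by
  funext N ζ
  simp only [dampedState, damp, Pi.zero_apply, sub_zero, abs_zero, zero_mul, neg_zero,
    Real.exp_zero, Complex.ofReal_one, one_mul]
  rfl

lemma exists_mem_graph_wickExpProdCoeff (m : ℝ) {n : ℕ} (f : Fin n → 𝓢(Spacetime, ℂ))
    (k : Fin n →₀ ℕ) :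
    ∃ Ψ : Fock m, HasWaveFunctions Ψ (dampedState m f k 0 0) ∧
      (vacuum m, (∏ i, ((k i)! : ℂ)⁻¹) • Ψ) ∈ (wickExpProdCoeff m f k).graph := by
  induction n with
  | zero =>
    refine ⟨vacuum m, hasWaveFunctions_vacuum m, (LinearPMap.mem_graph_iff _).2
      ⟨⟨vacuum m, trivial⟩, rfl, ?_⟩⟩
    rw [Finset.univ_eq_empty, Finset.prod_empty, one_smul]
    rfl
  | succ n ih =>
    obtain ⟨Ψ, hΨ, hgraph⟩ := ih (Fin.tail f) k.tail
    have hrapid := rapidFamily_dampedState m (Fin.tail f) k.tail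
    obtain ⟨Ψ', hΨ'⟩ := (hrapid.wickValue m (k 0) (f 0)).exists_hasWaveFunctions m 0
    have hfactor : (Ψ, ((k 0)! : ℂ)⁻¹ • Ψ') ∈ (wickExpCoeff m (f 0) (k 0)).graph :=
      mem_graph_smul _ (hrapid.mem_graph_wickPower (k 0) (f 0) 0 hΨ hΨ')
    refine ⟨Ψ', by rw [dampedState_zero_succ]; exact hΨ', ?_⟩
    rw [wickExpProdCoeff_succ, Fin.prod_univ_succ, mul_comm, mul_smul]
    exact mem_graph_opMul hgraph (Submodule.smul_mem _ (∏ i, ((k.tail i)! : ℂ)⁻¹) hfactor)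

lemma vacuum_mem_domain_wickExpProdCoeff (m : ℝ) {n : ℕ} (f : Fin n → 𝓢(Spacetime, ℂ))
    (k : Fin n →₀ ℕ) : vacuum m ∈ (wickExpProdCoeff m f k).domain := by
  obtain ⟨_, _, hgraph⟩ := exists_mem_graph_wickExpProdCoeff m f k
  exact LinearPMap.mem_domain_of_mem_graph hgraph

lemma coeff_vev (m : ℝ) {n : ℕ} (f : Fin n → 𝓢(Spacetime, ℂ)) (k : Fin n →₀ ℕ) :
    MvPowerSeries.coeff k (vev m f) = (∏ i, ((k i)! : ℂ)⁻¹) * dampedState m f k 0 0 0 ![] := by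
  obtain ⟨Ψ, hΨ, hgraph⟩ := exists_mem_graph_wickExpProdCoeff m f k
  obtain ⟨⟨_, hdom⟩, rfl, hval⟩ := (LinearPMap.mem_graph_iff _).1 hgraph
  rw [← hΨ.inner_vacuum, ← inner_smul_right]
  exact (dif_pos hdom).trans (congrArg _ hval)

/-! ### Plane waves and the two-point function -/

/-- The normalization `π^{1/2} (2π)⁻²` of one leg of a Wick power. -/
def legConst : ℂ := ((√Real.pi : ℝ) : ℂ) * ((2 * Real.pi : ℝ) : ℂ)⁻¹ ^ 2

/-- The normalized wave function `c e^{i ξ·z}`, with `c = legConst`, of a particle created at the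
point `z = (x⁰ + i s, 𝐱)`. -/
def outWave (m s : ℝ) (x : Spacetime) (ξ : Momentum) : ℂ :=
  legConst * Complex.exp (Complex.I * (mink (onShell m ξ) x : ℂ)) *
    (Real.exp (-(s * energy m ξ)) : ℂ)

/-- The normalized amplitude `c e^{-i η·x}`, with `c = legConst`, of the absorption of a particle
at the point `x`. -/
def inWave (m : ℝ) (x : Spacetime) (η : Momentum) : ℂ :=
  legConst * Complex.exp (-Complex.I * (mink (onShell m η) x : ℂ))

lemma norm_exp_I_mul_ofReal (θ : ℝ) : ‖Complex.exp (Complex.I * (θ : ℂ))‖ = 1 := by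
  rw [mul_comm, Complex.norm_exp_ofReal_mul_I]

lemma norm_exp_neg_I_mul_ofReal (θ : ℝ) : ‖Complex.exp (-Complex.I * (θ : ℂ))‖ = 1 := by
  simpa using norm_exp_I_mul_ofReal (-θ)

lemma legConst_sq : legConst ^ 2 = ((2 * (2 * Real.pi) ^ 3 : ℝ) : ℂ)⁻¹ := by
  have hreal : (√Real.pi * (2 * Real.pi)⁻¹ ^ 2) ^ 2 = (2 * (2 * Real.pi) ^ 3)⁻¹ := by
    rw [mul_pow, Real.sq_sqrt Real.pi_pos.le]
    field_simp
  rw [legConst]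
  exact_mod_cast congrArg Complex.ofReal hreal

lemma wickConst_mul (l : ℕ) :
    ((√Real.pi ^ l / (2 * Real.pi) ^ (2 * ((l : ℤ) - 1)) : ℝ) : ℂ) * ((2 * Real.pi : ℝ) : ℂ)⁻¹ ^ 2
      = legConst ^ l := by
  have hpi : (2 * Real.pi) ≠ 0 := by positivity
  have hpow : (2 * Real.pi) ^ (2 * ((l : ℤ) - 1))
      = (2 * Real.pi) ^ (2 * l) / (2 * Real.pi) ^ 2 := by
    rw [mul_sub, zpow_sub₀ hpi]; norm_cast
  have hreal : √Real.pi ^ l / (2 * Real.pi) ^ (2 * ((l : ℤ) - 1)) * (2 * Real.pi)⁻¹ ^ 2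
      = (√Real.pi * (2 * Real.pi)⁻¹ ^ 2) ^ l := by
    rw [hpow, mul_pow _ _ l, ← pow_mul, inv_pow, inv_pow]
    field_simp
  rw [legConst]
  simpa only [Complex.ofReal_mul, Complex.ofReal_pow, Complex.ofReal_inv]
    using congrArg Complex.ofReal hreal

lemma outWave_add (m s s' : ℝ) (x : Spacetime) (ξ : Momentum) :
    outWave m (s + s') x ξ = (Real.exp (-(s * energy m ξ)) : ℂ) * outWave m s' x ξ := by
  have hexp : Real.exp (-((s + s') * energy m ξ))
      = Real.exp (-(s * energy m ξ)) * Real.exp (-(s' * energy m ξ)) := by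
    rw [← Real.exp_add]; ring_nf
  rw [outWave, outWave, hexp, Complex.ofReal_mul]
  ring

lemma continuous_outWave (m s : ℝ) :
    Continuous fun q : Spacetime × Momentum => outWave m s q.1 q.2 := by
  have henergy := continuous_energy m
  have hmink : Continuous fun q : Spacetime × Momentum => mink (onShell m q.2) q.1 :=
    continuous_mink_comp ((continuous_onShell m).comp continuous_snd) continuous_fst
  unfold outWave
  fun_prop

lemma continuous_inWave (m : ℝ) :
    Continuous fun q : Spacetime × Momentum => inWave m q.1 q.2 := by
  have hmink : Continuous fun q : Spacetime × Momentum => mink (onShell m q.2) q.1 :=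
    continuous_mink_comp ((continuous_onShell m).comp continuous_snd) continuous_fst
  unfold inWave
  fun_prop

lemma norm_outWave (m s : ℝ) (x : Spacetime) (ξ : Momentum) :
    ‖outWave m s x ξ‖ = ‖legConst‖ * Real.exp (-(s * energy m ξ)) := by
  rw [outWave, norm_mul, norm_mul, norm_exp_I_mul_ofReal, mul_one, Complex.norm_real,
    Real.norm_of_nonneg (Real.exp_pos _).le]

lemma norm_outWave_le (m : ℝ) {s : ℝ} (hs : 0 ≤ s) (x : Spacetime) (ξ : Momentum) :
    ‖outWave m s x ξ‖ ≤ ‖legConst‖ := by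
  rw [norm_outWave]
  exact mul_le_of_le_one_right (norm_nonneg _)
    (Real.exp_le_one_iff.2 (neg_nonpos.2 (mul_nonneg hs (energy_nonneg m ξ))))

lemma norm_inWave_mul_outWave (m s : ℝ) (x x' : Spacetime) (p : Momentum) :
    ‖inWave m x p * outWave m s x' p‖ = ‖legConst‖ ^ 2 * Real.exp (-(s * energy m p)) := by
  rw [norm_mul, norm_outWave, inWave, norm_mul, norm_exp_neg_I_mul_ofReal]
  ring

lemma integrable_inWave_mul_outWave (m : ℝ) {s : ℝ} (hs : 0 < s) (x x' : Spacetime) :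
    Integrable (fun p => inWave m x p * outWave m s x' p) (Omega m) := by
  refine ((integrable_exp_neg_energy m hs).const_mul (‖legConst‖ ^ 2)).mono' ?_
    (ae_of_all _ fun p => (norm_inWave_mul_outWave m s x x' p).le)
  exact (((continuous_inWave m).comp (Continuous.prodMk_right x)).mul
    ((continuous_outWave m s).comp (Continuous.prodMk_right x'))).aestronglyMeasurable

lemma exp_twoPoint_phase (m s : ℝ) (x x' : Spacetime) (p : Momentum) :
    Complex.exp (-Complex.I * (energy m p : ℂ) *
        (((x - x') 0 : ℝ) + Complex.I * ((-s : ℝ) : ℂ))) * Complex.exp (Complex.I *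
        ((p 0 * (x - x') 1 + p 1 * (x - x') 2 + p 2 * (x - x') 3 : ℝ) : ℂ))
      = Complex.exp (-Complex.I * (mink (onShell m p) x : ℂ)) *
        Complex.exp (Complex.I * (mink (onShell m p) x' : ℂ)) *
        (Real.exp (-(s * energy m p)) : ℂ) := by
  have hmink : mink (onShell m p) x = mink (onShell m p) x' + (energy m p * (x - x') 0
      - (p 0 * (x - x') 1 + p 1 * (x - x') 2 + p 2 * (x - x') 3)) := by
    rw [← sub_eq_iff_eq_add', ← mink_sub_right]
    simp [mink, onShell]
    ring
  rw [Complex.ofReal_exp, ← Complex.exp_add, ← Complex.exp_add, ← Complex.exp_add, hmink]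
  congr 1
  push_cast
  linear_combination (energy m p * s : ℂ) * Complex.I_sq

lemma twoPoint_eq_integral (m s : ℝ) (x x' : Spacetime) :
    twoPoint m (x - x') (-s) = ∫ p, inWave m x p * outWave m s x' p ∂(Omega m) := by
  rw [integral_Omega, twoPoint, ← integral_const_mul, ← legConst_sq]
  refine integral_congr_ae (ae_of_all _ fun p => ?_)
  simp only [inWave, outWave]
  rw [mul_assoc (((energy m p : ℝ) : ℂ)⁻¹), exp_twoPoint_phase]
  ring

/-! ### Bounded continuous families of polynomials -/

section BoundedContinuous

variable {Z : Type*} [TopologicalSpace Z] {n : ℕ}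

/-- A bounded continuous complex-valued function. The unbundled form of `BoundedContinuousFunction`
suits functions given by explicit formulas. -/
def BddCont (F : Z → ℂ) : Prop :=
  Continuous F ∧ ∃ C, ∀ z, ‖F z‖ ≤ C

/-- A family of polynomials whose coefficients are bounded continuous functions of the
parameter. -/
def PolyBddCont (P : Z → MvPolynomial (Fin n) ℂ) : Prop :=
  ∀ k, BddCont fun z => MvPolynomial.coeff k (P z)

lemma BddCont.const (c : ℂ) : BddCont fun _ : Z => c := ⟨continuous_const, ‖c‖, fun _ => le_rfl⟩

lemma BddCont.mul {F G : Z → ℂ} (hF : BddCont F) (hG : BddCont G) :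
    BddCont fun z => F z * G z := by
  obtain ⟨hFcont, C, hC⟩ := hF
  obtain ⟨hGcont, D, hD⟩ := hG
  refine ⟨hFcont.mul hGcont, C * D, fun z => ?_⟩
  rw [norm_mul]
  exact mul_le_mul (hC z) (hD z) (norm_nonneg _) ((norm_nonneg _).trans (hC z))

lemma BddCont.sum {ι : Type*} {s : Finset ι} {F : ι → Z → ℂ} (h : ∀ i ∈ s, BddCont (F i)) :
    BddCont fun z => ∑ i ∈ s, F i z := by
  choose! C hC using fun i hi => (h i hi).2
  exact ⟨continuous_finsetSum s fun i hi => (h i hi).1, ∑ i ∈ s, C i,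
    fun z => norm_sum_le_of_le s fun i hi => hC i hi z⟩

lemma BddCont.comp {Y : Type*} [TopologicalSpace Y] {F : Z → ℂ} (hF : BddCont F) {g : Y → Z}
    (hg : Continuous g) : BddCont fun y => F (g y) :=
  ⟨hF.1.comp hg, hF.2.imp fun _ h y => h (g y)⟩

lemma PolyBddCont.const_mul_C (P : MvPolynomial (Fin n) ℂ) {F : Z → ℂ} (hF : BddCont F) :
    PolyBddCont fun z => P * MvPolynomial.C (F z) := fun k => by
  simpa only [mul_comm P, MvPolynomial.coeff_C_mul] using hF.mul (BddCont.const _)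

lemma PolyBddCont.mul {P Q : Z → MvPolynomial (Fin n) ℂ} (hP : PolyBddCont P)
    (hQ : PolyBddCont Q) : PolyBddCont fun z => P z * Q z := by
  classical
  intro k
  simp only [MvPolynomial.coeff_mul]
  exact BddCont.sum fun a _ => (hP a.1).mul (hQ a.2)

lemma PolyBddCont.sum {ι : Type*} {s : Finset ι} {P : ι → Z → MvPolynomial (Fin n) ℂ}
    (h : ∀ i ∈ s, PolyBddCont (P i)) : PolyBddCont fun z => ∑ i ∈ s, P i z := by
  intro k
  simp only [MvPolynomial.coeff_sum]
  exact BddCont.sum fun i hi => h i hi k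

lemma PolyBddCont.prod {ι : Type*} {s : Finset ι} {P : ι → Z → MvPolynomial (Fin n) ℂ}
    (h : ∀ i ∈ s, PolyBddCont (P i)) : PolyBddCont fun z => ∏ i ∈ s, P i z := by
  classical
  induction s using Finset.induction_on with
  | empty => exact fun k => BddCont.const _
  | insert a s ha ih =>
    simp only [Finset.prod_insert ha]
    exact (h a (Finset.mem_insert_self a s)).mul
      (ih fun i hi => h i (Finset.mem_insert_of_mem hi))

lemma PolyBddCont.pow {P : Z → MvPolynomial (Fin n) ℂ} (hP : PolyBddCont P) (d : ℕ) :
    PolyBddCont fun z => P z ^ d := by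
  simpa using PolyBddCont.prod (s := Finset.range d) fun _ _ => hP

lemma PolyBddCont.linForm {c : Z → Fin n → ℂ} (hc : ∀ a, BddCont fun z => c z a) :
    PolyBddCont fun z => linForm (c z) :=
  PolyBddCont.sum fun a _ => PolyBddCont.const_mul_C _ (hc a)

lemma PolyBddCont.quadForm {t : Z → Fin n → Fin n → ℂ}
    (ht : ∀ i j, i < j → BddCont fun z => t z i j) : PolyBddCont fun z => quadForm (t z) :=
  PolyBddCont.sum fun i _ => PolyBddCont.sum fun j hj =>
    PolyBddCont.const_mul_C _ (ht i j (Finset.mem_Ioi.1 hj))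

lemma BddCont.genCoeff {t : Z → Fin n → Fin n → ℂ}
    (ht : ∀ i j, i < j → BddCont fun z => t z i j) {Q : Z → MvPolynomial (Fin n) ℂ}
    (hQ : PolyBddCont Q) (k : Fin n →₀ ℕ) : BddCont fun z => genCoeff (t z) k (Q z) := by
  simp only [genCoeff_eq_sum_range _ k _ (Nat.lt_succ_self k.degree)]
  exact BddCont.sum fun d _ =>
    (BddCont.const _).mul ((((PolyBddCont.quadForm ht).pow d).mul hQ) k)

end BoundedContinuous

lemma bddCont_twoPoint (m : ℝ) {s : ℝ} (hs : s < 0) : BddCont fun x => twoPoint m x s := by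
  have hwave : ∀ x, twoPoint m x s = ∫ p, inWave m x p * outWave m (-s) 0 p ∂(Omega m) :=
    fun x => by rw [← twoPoint_eq_integral, sub_zero, neg_neg]
  have hbound := fun x => ae_of_all (Omega m) fun p => (norm_inWave_mul_outWave m (-s) x 0 p).le
  have hdom := (integrable_exp_neg_energy m (neg_pos.2 hs)).const_mul (‖legConst‖ ^ 2)
  simp only [hwave]
  refine ⟨continuous_of_dominated
    (fun x => (integrable_inWave_mul_outWave m (neg_pos.2 hs) x 0).aestronglyMeasurable)
    hbound hdom (ae_of_all _ fun p => ?_), _, fun x => norm_integral_le_of_norm_le hdom (hbound x)⟩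
  exact ((continuous_inWave m).comp (Continuous.prodMk_left p)).mul continuous_const

/-! ### States with unsmeared vertices -/

/-- The two-point functions `t_{ac} = D_m^{(-)}(z_a - z_c)` of the points `z_a` with times
`x_a⁰ + i y_a`. -/
def twoPoints (m : ℝ) {n : ℕ} (y : Fin n → ℝ) (x : Fin n → Spacetime) (a c : Fin n) : ℂ :=
  twoPoint m (x a - x c) (y a - y c)

/-- The one-particle generating function `∑_a X_a u_a(ξ)`, where `u_a` is the wave function of a
particle created at the point `z_a` with time `x_a⁰ + i y_a` and damped by `e^{bH}`. -/
def outForm (m : ℝ) {n : ℕ} (y : Fin n → ℝ) (b : ℝ) (x : Fin n → Spacetime) (ξ : Momentum) :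
    MvPolynomial (Fin n) ℂ :=
  linForm fun a => outWave m (y a - b) (x a) ξ

/-- The wave functions of `e^{bH} :φ^{k₁}:(z₁) ⋯ :φ^{k_n}:(z_n) Φ₀` at the points `z_a` with times
`x_a⁰ + i y_a`, where `H` is the energy operator. -/
def pointState (m : ℝ) {n : ℕ} (k : Fin n →₀ ℕ) (y : Fin n → ℝ) (b : ℝ) (x : Fin n → Spacetime)
    (N : ℕ) (ξ : Fin N → Momentum) : ℂ :=
  (∏ a, ((k a)! : ℂ)) * ((√(N ! : ℝ) : ℝ) : ℂ)⁻¹ *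
    genCoeff (twoPoints m y x) k (∏ r, outForm m y b x (ξ r))

lemma linForm_smul {R : Type*} [CommSemiring R] {n : ℕ} (c : R) (v : Fin n → R) :
    linForm (fun a => c * v a) = c • linForm v := by
  simp only [linForm, Finset.smul_sum, MvPolynomial.smul_eq_C_mul, map_mul, mul_left_comm]

lemma outForm_eq_smul (m : ℝ) {n : ℕ} (y : Fin n → ℝ) (b δ : ℝ) (x : Fin n → Spacetime)
    (ξ : Momentum) :
    outForm m y b x ξ = (Real.exp (-(δ * energy m ξ)) : ℂ) • outForm m y (b + δ) x ξ := by
  have hsub : ∀ a, y a - b = δ + (y a - (b + δ)) := fun a => by ring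
  simp only [outForm, ← linForm_smul, ← outWave_add, ← hsub]

lemma pointState_eq_exp_mul (m : ℝ) {n : ℕ} (k : Fin n →₀ ℕ) (y : Fin n → ℝ) (b δ : ℝ)
    (x : Fin n → Spacetime) (N : ℕ) (ξ : Fin N → Momentum) :
    pointState m k y b x N ξ
      = (Real.exp (-(δ * ∑ r, energy m (ξ r))) : ℂ) * pointState m k y (b + δ) x N ξ := by
  have hprod : ∏ r, outForm m y b x (ξ r)
      = (Real.exp (-(δ * ∑ r, energy m (ξ r))) : ℂ) • ∏ r, outForm m y (b + δ) x (ξ r) := by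
    simp only [outForm_eq_smul m y b δ x, Finset.prod_smul]
    rw [← Complex.ofReal_prod, ← Real.exp_sum, Finset.mul_sum, Finset.sum_neg_distrib]
  rw [pointState, pointState, hprod, map_smul, smul_eq_mul]
  ring

lemma pointState_fin_zero (m : ℝ) (k : Fin 0 →₀ ℕ) (y : Fin 0 → ℝ) (b : ℝ)
    (x : Fin 0 → Spacetime) (N : ℕ) (ξ : Fin N → Momentum) :
    pointState m k y b x N ξ = vacFn N ξ := by
  obtain rfl : k = 0 := Subsingleton.elim _ _
  rw [pointState, genCoeff_eq_sum_range _ _ _ (D := 1) (by simp)]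
  rcases N with _ | N <;> simp [vacFn, outForm, linForm]

lemma bddCont_pointState (m : ℝ) {n : ℕ} (k : Fin n →₀ ℕ) {y : Fin n → ℝ} (hy : StrictMono y)
    {b : ℝ} (hb : ∀ a, b ≤ y a) (N : ℕ) :
    BddCont fun q : (Fin n → Spacetime) × (Fin N → Momentum) => pointState m k y b q.1 N q.2 := by
  refine (BddCont.const _).mul (BddCont.genCoeff (fun i j hij => ?_)
    (PolyBddCont.prod fun r _ => PolyBddCont.linForm fun a => ?_) k)
  · exact (bddCont_twoPoint m (sub_neg.2 (hy hij))).comp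
      (g := fun q : (Fin n → Spacetime) × (Fin N → Momentum) => q.1 i - q.1 j) (by fun_prop)
  · have houtWave : BddCont fun q : Spacetime × Momentum => outWave m (y a - b) q.1 q.2 :=
      ⟨continuous_outWave m _, _, fun q => norm_outWave_le m (sub_nonneg.2 (hb a)) q.1 q.2⟩
    exact houtWave.comp
      (g := fun q : (Fin n → Spacetime) × (Fin N → Momentum) => (q.1 a, q.2 r)) (by fun_prop)

/-! ### Contractions -/

lemma genCoeff_prod_linForm_mul {n : ℕ} {ι : Type*} [Fintype ι] [DecidableEq ι]
    (t : Fin n → Fin n → ℂ) (k : Fin n →₀ ℕ) (v : ι → Fin n → ℂ) (Q : MvPolynomial (Fin n) ℂ) :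
    genCoeff t k ((∏ r, linForm (v r)) * Q)
      = ∑ c : ι → Fin n, (∏ r, v r (c r)) * genCoeff t k ((∏ r, MvPolynomial.X (c r)) * Q) := by
  simp only [linForm]
  rw [Finset.prod_univ_sum, Fintype.piFinset_univ, Finset.sum_mul, map_sum]
  refine Finset.sum_congr rfl fun c _ => ?_
  rw [Finset.prod_mul_distrib, ← map_prod, mul_comm (∏ r, MvPolynomial.X (c r)), mul_assoc,
    ← MvPolynomial.smul_eq_C_mul, map_smul, smul_eq_mul]

lemma integral_prod_mul_genCoeff {E : Type*} [MeasurableSpace E] (μ : Measure E) [SigmaFinite μ]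
    {n j : ℕ} (t : Fin n → Fin n → ℂ) (k : Fin n →₀ ℕ) {w : E → ℂ} {v : Fin n → E → ℂ}
    (hwv : ∀ a, Integrable (fun p => w p * v a p) μ) (Q : MvPolynomial (Fin n) ℂ) :
    ∫ η : Fin j → E, (∏ r, w (η r)) *
        genCoeff t k ((∏ r, linForm fun a => v a (η r)) * Q) ∂(Measure.pi fun _ => μ)
      = genCoeff t k ((linForm fun a => ∫ p, w p * v a p ∂μ) ^ j * Q) := by
  have hexpand : ∀ η : Fin j → E,
      (∏ r, w (η r)) * genCoeff t k ((∏ r, linForm fun a => v a (η r)) * Q)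
      = ∑ c : Fin j → Fin n, (∏ r, w (η r) * v (c r) (η r)) *
          genCoeff t k ((∏ r, MvPolynomial.X (c r)) * Q) := fun η => by
    simp only [genCoeff_prod_linForm_mul, Finset.mul_sum, Finset.prod_mul_distrib, mul_assoc]
  have hpow : (linForm fun a => ∫ p, w p * v a p ∂μ) ^ j
      = ∏ _r : Fin j, linForm fun a => ∫ p, w p * v a p ∂μ := by
    simp
  simp only [hexpand]
  rw [hpow, genCoeff_prod_linForm_mul, integral_finsetSum]
  · refine Finset.sum_congr rfl fun c _ => ?_
    rw [integral_mul_const, integral_fintype_prod_eq_prod fun r p => w p * v (c r) p]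
  · exact fun c _ => (Integrable.fintype_prod fun r => hwv (c r)).mul_const _

lemma legConst_pow_mul_exp (m : ℝ) (x : Spacetime) {ι κ : Type*} [Fintype ι] (η : ι → Momentum)
    (S : Finset κ) (ξ : κ → Momentum) :
    legConst ^ (Fintype.card ι + S.card) * Complex.exp (-Complex.I *
        (mink (∑ r, onShell m (η r) - ∑ i ∈ S, onShell m (ξ i)) x : ℂ))
      = (∏ r, inWave m x (η r)) * ∏ i ∈ S, outWave m 0 x (ξ i) := by
  simp only [inWave, outWave, zero_mul, neg_zero, Real.exp_zero, Complex.ofReal_one, mul_one,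
    Finset.prod_mul_distrib, Finset.prod_const, Finset.card_univ]
  rw [← Complex.exp_sum, ← Complex.exp_sum, mul_mul_mul_comm, ← Complex.exp_add, ← pow_add,
    mink_sub_left, mink_sum_left, mink_sum_left, ← Finset.mul_sum, ← Finset.mul_sum]
  congr 2
  push_cast
  ring

/-- The integrand of `contraction`: the unsmeared counterpart of `wickIntegrand`, with the state
created at the points other than `x 0`. The momenta `η` are absorbed at `x 0`. -/
def contractionIntegrand (m : ℝ) {n : ℕ} (k : Fin (n + 1) →₀ ℕ) (y : Fin (n + 1) → ℝ)
    (x : Fin (n + 1) → Spacetime) {N : ℕ} (ξ : Fin N → Momentum) (S : Finset (Fin N)) (j : ℕ)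
    (η : Fin j → Momentum) : ℂ :=
  Complex.exp (-Complex.I *
      (mink (∑ r, onShell m (η r) - ∑ i ∈ S, onShell m (ξ i)) (x 0) : ℂ)) *
    pointState m k.tail (Fin.tail y) (y 0) (Fin.tail x) (j + Sᶜ.card)
      (Fin.append η (ξ ∘ Sᶜ.orderEmbOfFin rfl))

/-- The term of the action of an unsmeared Wick power at `x 0` in which `j` particles are absorbed
and the particles in `S` are created. -/
def contraction (m : ℝ) {n : ℕ} (k : Fin (n + 1) →₀ ℕ) (y : Fin (n + 1) → ℝ)
    (x : Fin (n + 1) → Spacetime) {N : ℕ} (ξ : Fin N → Momentum) (S : Finset (Fin N)) (j : ℕ) : ℂ :=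
  ∫ η, contractionIntegrand m k y x ξ S j η ∂(OmegaPi m (Fin j))

section

variable (m : ℝ) {n : ℕ} (k : Fin (n + 1) →₀ ℕ) {y : Fin (n + 1) → ℝ} (x : Fin (n + 1) → Spacetime)
  {N : ℕ} (ξ : Fin N → Momentum)

lemma twoPoints_zero_succ (a : Fin n) :
    twoPoints m y x 0 a.succ
      = ∫ p, inWave m (x 0) p * outWave m (y a.succ - y 0) (x a.succ) p ∂(Omega m) := by
  rw [← twoPoint_eq_integral, twoPoints, neg_sub]

/-- Absorbing one of the particles created at `x a` contributes a two-point function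
`t_{0 a}`. -/
lemma legConst_pow_mul_contraction (hy : ∀ a : Fin n, y 0 < y a.succ) (S : Finset (Fin N))
    (j : ℕ) :
    legConst ^ (j + S.card) * contraction m k y x ξ S j
      = (∏ a, ((k.tail a)! : ℂ)) * ((√((j + Sᶜ.card)! : ℝ) : ℝ) : ℂ)⁻¹ *
        (∏ i ∈ S, outWave m 0 (x 0) (ξ i)) *
        genCoeff (twoPoints m (Fin.tail y) (Fin.tail x)) k.tail
          ((linForm fun a : Fin n => twoPoints m y x 0 a.succ) ^ j *
            ∏ i ∈ Sᶜ, outForm m (Fin.tail y) (y 0) (Fin.tail x) (ξ i)) := by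
  simp only [twoPoints_zero_succ]
  rw [← integral_prod_mul_genCoeff (Omega m) _ _
    fun a => integrable_inWave_mul_outWave m (sub_pos.2 (hy a)) _ _, contraction,
    ← integral_const_mul, ← integral_const_mul]
  refine integral_congr_ae (ae_of_all _ fun η => ?_)
  beta_reduce
  have hprod : ∏ r, outForm m (Fin.tail y) (y 0) (Fin.tail x)
        (Fin.append η (ξ ∘ Sᶜ.orderEmbOfFin rfl) r)
      = (∏ r, linForm fun a : Fin n => outWave m (y a.succ - y 0) (x a.succ) (η r)) *
        ∏ i ∈ Sᶜ, outForm m (Fin.tail y) (y 0) (Fin.tail x) (ξ i) := by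
    simp only [Fin.prod_univ_add, Fin.append_left, Fin.append_right, Function.comp_apply]
    rw [prod_orderEmbOfFin Sᶜ fun i => outForm m (Fin.tail y) (y 0) (Fin.tail x) (ξ i)]
    rfl
  have hphase := legConst_pow_mul_exp m (x 0) η S ξ
  rw [Fintype.card_fin] at hphase
  rw [contractionIntegrand, pointState, hprod, ← mul_assoc, hphase]
  ring

lemma legConst_pow_mul_contraction_term (hy : ∀ a : Fin n, y 0 < y a.succ) (S : Finset (Fin N))
    {j : ℕ} (hj : j + S.card = k 0) :
    legConst ^ k 0 * (((√(((N + 2 * j - k 0)! : ℝ) / (N ! : ℝ)) : ℝ) : ℂ) *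
        ((((k 0)! : ℂ) / (j ! : ℂ)) * contraction m k y x ξ S j))
      = (∏ a, ((k a)! : ℂ)) * ((√(N ! : ℝ) : ℝ) : ℂ)⁻¹ * ((j ! : ℂ)⁻¹ *
        genCoeff (twoPoints m (Fin.tail y) (Fin.tail x)) k.tail
          ((linForm fun a : Fin n => twoPoints m y x 0 a.succ) ^ j *
            (MvPolynomial.C (∏ i ∈ S, outWave m 0 (x 0) (ξ i)) *
              ∏ i ∈ Sᶜ, outForm m (Fin.tail y) (y 0) (Fin.tail x) (ξ i)))) := by
  have hcontr := legConst_pow_mul_contraction m k x ξ hy S j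
  have hM : N + 2 * j - k 0 = j + Sᶜ.card := by
    have hS : S.card ≤ N := by simpa using S.card_le_univ
    rw [Finset.card_compl, Fintype.card_fin]
    omega
  have hsqrt : √((N + 2 * j - k 0)! / (N ! : ℝ)) * (√((j + Sᶜ.card)! : ℝ))⁻¹
      = (√(N ! : ℝ))⁻¹ := by
    rw [hM, Real.sqrt_div (by positivity)]
    field_simp
  rw [mul_left_comm _ (MvPolynomial.C _), ← MvPolynomial.smul_eq_C_mul, map_smul, smul_eq_mul,
    Fin.prod_univ_succ, ← Complex.ofReal_inv, ← hsqrt]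
  rw [hj] at hcontr
  simp only [Finsupp.tail_apply] at hcontr
  push_cast
  linear_combination ((√((N + 2 * j - k 0)! / (N ! : ℝ)) : ℝ) : ℂ) * ((k 0)! / (j ! : ℂ)) * hcontr

/-- The action of an unsmeared Wick power separates the variable `X_0` in the generating
function. -/
lemma legConst_pow_mul_sum_contraction (hy : ∀ a : Fin n, y 0 < y a.succ) :
    legConst ^ k 0 *
      ∑ j ∈ Finset.range (k 0 + 1), ((√(((N + 2 * j - k 0)! : ℝ) / (N ! : ℝ)) : ℝ) : ℂ) *
        ∑ S ∈ Finset.powersetCard (k 0 - j) (Finset.univ : Finset (Fin N)),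
          (((k 0)! : ℂ) / (j ! : ℂ)) * contraction m k y x ξ S j
      = pointState m k y (y 0) x N ξ := by
  have hcons := genCoeff_cons (twoPoints m y x) (k 0) k.tail (∏ r, outForm m y (y 0) x (ξ r))
  simp only [Finsupp.cons_tail, outForm, coeff_finSuccEquiv_prod_linForm, sub_self] at hcons
  simp only [pointState, outForm, hcons, Finset.mul_sum, map_sum]
  refine Finset.sum_congr rfl fun j hj => Finset.sum_congr rfl fun S hS => ?_
  refine legConst_pow_mul_contraction_term m k x ξ hy S ?_
  rw [(Finset.mem_powersetCard.1 hS).2]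
  exact Nat.add_sub_of_le (Finset.mem_range_succ_iff.1 hj)

end

/-! ### Smearing -/

lemma integral_cons_mul {E : Type*} [MeasureSpace E] [SigmaFinite (volume : Measure E)] {n : ℕ}
    (g : E → ℂ) (h : (Fin n → E) → ℂ) :
    ∫ x : Fin (n + 1) → E, g (x 0) * h (Fin.tail x) = (∫ x, g x) * ∫ x, h x := by
  rw [← integral_prod_mul, ← Measure.volume_eq_prod,
    ← (volume_preserving_piFinSuccAbove (fun _ : Fin (n + 1) => E) 0).integral_comp'
      (fun q : E × (Fin n → E) => g q.1 * h q.2)]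
  rfl

lemma integrable_prod_schwartz {n : ℕ} (f : Fin n → 𝓢(Spacetime, ℂ)) :
    Integrable fun x : Fin n → Spacetime => ∏ i, f i (x i) :=
  Integrable.fintype_prod fun i => (f i).integrable

lemma strictMono_tail {n : ℕ} {y : Fin (n + 1) → ℝ} (hy : StrictMono y) :
    StrictMono (Fin.tail y) :=
  hy.comp Fin.strictMono_succ

lemma exists_gap {n : ℕ} {y : Fin (n + 1) → ℝ} (hy : StrictMono y) :
    ∃ δ > 0, ∀ a : Fin n, y 0 + δ ≤ y a.succ := by
  cases n with
  | zero => exact ⟨1, one_pos, fun a => a.elim0⟩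
  | succ n =>
    refine ⟨y 1 - y 0, sub_pos.2 (hy Fin.zero_lt_one), fun a => ?_⟩
    rw [add_sub_cancel]
    exact hy.monotone (Fin.succ_le_succ_iff.2 (Fin.zero_le a))

section

variable (m : ℝ) {n : ℕ} (f : Fin (n + 1) → 𝓢(Spacetime, ℂ)) (k : Fin (n + 1) →₀ ℕ)
  {y : Fin (n + 1) → ℝ} (hy : StrictMono y) {N : ℕ} (ξ : Fin N → Momentum)
  (S : Finset (Fin N)) (j : ℕ)

include hy

lemma continuous_contractionIntegrand :
    Continuous fun q : (Fin j → Momentum) × (Fin (n + 1) → Spacetime) =>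
      contractionIntegrand m k y q.2 ξ S j q.1 := by
  have hshell := continuous_onShell m
  have hmink : Continuous fun q : (Fin j → Momentum) × (Fin (n + 1) → Spacetime) =>
      mink (∑ r, onShell m (q.1 r) - ∑ i ∈ S, onShell m (ξ i)) (q.2 0) :=
    continuous_mink_comp (by fun_prop) (by fun_prop)
  have htail : Continuous fun q : (Fin j → Momentum) × (Fin (n + 1) → Spacetime) =>
      Fin.tail q.2 := continuous_pi fun a => by unfold Fin.tail; fun_prop
  have hstate := (bddCont_pointState m k.tail (strictMono_tail hy)
    (fun a => hy.monotone (Fin.zero_le a.succ)) (j + Sᶜ.card)).1.comp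
    (htail.prodMk (continuous_append (g := Prod.fst) continuous_fst
      (continuous_const (y := ξ ∘ Sᶜ.orderEmbOfFin rfl))))
  exact (show Continuous fun q : (Fin j → Momentum) × (Fin (n + 1) → Spacetime) =>
    Complex.exp (-Complex.I *
      (mink (∑ r, onShell m (q.1 r) - ∑ i ∈ S, onShell m (ξ i)) (q.2 0) : ℂ)) by fun_prop).mul
    hstate

/-- The damping by the gap between `y 0` and the other `y a` makes the absorbed momenta
integrable. -/
lemma exists_norm_contractionIntegrand_le :
    ∃ δ > 0, ∃ C, ∀ x η, ‖contractionIntegrand m k y x ξ S j η‖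
      ≤ C * ∏ r, Real.exp (-(δ * energy m (η r))) := by
  obtain ⟨δ, hδ, hgap⟩ := exists_gap hy
  obtain ⟨-, C, hC⟩ := bddCont_pointState m k.tail (strictMono_tail hy) hgap (j + Sᶜ.card)
  refine ⟨δ, hδ, C, fun x η => ?_⟩
  have henergy : ∑ r, energy m (η r)
      ≤ ∑ r, energy m (Fin.append η (ξ ∘ Sᶜ.orderEmbOfFin rfl) r) := by
    simp only [Fin.sum_univ_add, Fin.append_left]
    exact le_add_of_nonneg_right (Finset.sum_nonneg fun i _ => energy_nonneg m _)
  rw [contractionIntegrand, norm_mul, norm_exp_neg_I_mul_ofReal, one_mul,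
    pointState_eq_exp_mul m _ _ _ δ, norm_mul, Complex.norm_real,
    Real.norm_of_nonneg (Real.exp_pos _).le, ← Real.exp_sum, Finset.sum_neg_distrib,
    ← Finset.mul_sum, mul_comm C]
  have hstate := hC (Fin.tail x, Fin.append η (ξ ∘ Sᶜ.orderEmbOfFin rfl))
  gcongr

lemma integrable_contractionIntegrand_mul :
    Integrable (fun q : (Fin j → Momentum) × (Fin (n + 1) → Spacetime) =>
      contractionIntegrand m k y q.2 ξ S j q.1 * ∏ i, f i (q.2 i))
      ((OmegaPi m (Fin j)).prod volume) := by
  obtain ⟨δ, hδ, C, hC⟩ := exists_norm_contractionIntegrand_le m k hy ξ S j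
  have hdamp : Integrable (fun η : Fin j → Momentum => ∏ r, Real.exp (-(δ * energy m (η r))))
      (OmegaPi m (Fin j)) :=
    Integrable.fintype_prod fun _ => integrable_exp_neg_energy m hδ
  have hf : Continuous fun q : (Fin j → Momentum) × (Fin (n + 1) → Spacetime) =>
      ∏ i, f i (q.2 i) :=
    continuous_finsetProd _ fun i _ => (f i).continuous.comp (by fun_prop)
  refine ((hdamp.mul_prod (integrable_prod_schwartz f).norm).const_mul C).mono'
    ((continuous_contractionIntegrand m k hy ξ S j).mul hf).aestronglyMeasurable
    (ae_of_all _ fun q => ?_)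
  rw [norm_mul, ← mul_assoc]
  exact mul_le_mul_of_nonneg_right (hC q.2 q.1) (norm_nonneg _)

lemma integrable_contraction_mul :
    Integrable fun x : Fin (n + 1) → Spacetime => contraction m k y x ξ S j * ∏ i, f i (x i) := by
  simpa only [integral_mul_const, contraction] using
    (integrable_contractionIntegrand_mul m f k hy ξ S j).integral_prod_right

lemma integral_wickIntegrand {Φ : WaveFunctions}
    (hΦ : ∀ M ζ, Φ M ζ = ∫ x : Fin n → Spacetime,
      pointState m k.tail (Fin.tail y) (y 0) x M ζ * ∏ i, f i.succ (x i)) :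
    ∫ η, wickIntegrand m (f 0) Φ ξ S j η ∂(OmegaPi m (Fin j))
      = ((2 * Real.pi : ℝ) : ℂ)⁻¹ ^ 2 *
        ∫ x : Fin (n + 1) → Spacetime, contraction m k y x ξ S j * ∏ i, f i (x i) := by
  have hjoint : ∀ η, wickIntegrand m (f 0) Φ ξ S j η = ((2 * Real.pi : ℝ) : ℂ)⁻¹ ^ 2 *
      ∫ x : Fin (n + 1) → Spacetime, contractionIntegrand m k y x ξ S j η * ∏ i, f i (x i) := by
    intro η
    rw [wickIntegrand, ftilde, hΦ, mul_assoc, ← integral_cons_mul]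
    congr 2 with x
    rw [contractionIntegrand, Fin.prod_univ_succ]
    simp only [Fin.tail]
    ring
  simp only [hjoint, contraction, ← integral_mul_const]
  rw [integral_const_mul,
    integral_integral_swap (integrable_contractionIntegrand_mul m f k hy ξ S j)]

lemma wickValue_eq_integral_pointState {Φ : WaveFunctions}
    (hΦ : ∀ M ζ, Φ M ζ = ∫ x : Fin n → Spacetime,
      pointState m k.tail (Fin.tail y) (y 0) x M ζ * ∏ i, f i.succ (x i)) :
    wickValue m (k 0) (f 0) Φ N ξ
      = ∫ x : Fin (n + 1) → Spacetime, pointState m k y (y 0) x N ξ * ∏ i, f i (x i) := by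
  have hI := fun S j => integrable_contraction_mul m f k hy ξ S j
  simp only [← legConst_pow_mul_sum_contraction m k _ ξ fun a => hy (Fin.succ_pos a),
    Finset.mul_sum, Finset.sum_mul, mul_assoc]
  rw [integral_finsetSum _ fun j _ => integrable_finsetSum _ fun S _ =>
    (((hI S j).const_mul _).const_mul _).const_mul _, wickValue, Finset.mul_sum]
  refine Finset.sum_congr rfl fun j _ => ?_
  rw [integral_finsetSum _ fun S _ => (((hI S j).const_mul _).const_mul _).const_mul _,
    Finset.mul_sum, Finset.mul_sum]
  refine Finset.sum_congr rfl fun S _ => ?_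
  rw [integral_wickIntegrand m f k hy ξ S j hΦ, ← wickConst_mul]
  simp only [integral_const_mul]
  ring

end

lemma dampedState_eq_integral (m : ℝ) {n : ℕ} (f : Fin n → 𝓢(Spacetime, ℂ)) (k : Fin n →₀ ℕ)
    {y : Fin n → ℝ} (hy : StrictMono y) {b : ℝ} (hb : ∀ a, b ≤ y a) (N : ℕ)
    (ξ : Fin N → Momentum) :
    dampedState m f k y b N ξ
      = ∫ x : Fin n → Spacetime, pointState m k y b x N ξ * ∏ i, f i (x i) := by
  induction n generalizing b N with
  | zero =>
    simp only [pointState_fin_zero, Finset.univ_eq_empty, Finset.prod_empty, mul_one]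
    rw [volume_pi, Measure.pi_of_empty _ fun i : Fin 0 => i.elim0]
    simp [dampedState]
  | succ n ih =>
    have htail : ∀ M ζ, dampedState m (Fin.tail f) k.tail (Fin.tail y) (y 0) M ζ
        = ∫ x : Fin n → Spacetime, pointState m k.tail (Fin.tail y) (y 0) x M ζ *
          ∏ i, f i.succ (x i) := fun M ζ =>
      ih (Fin.tail f) k.tail (strictMono_tail hy) (fun a => hy.monotone (Fin.zero_le _)) M ζ
    have hdamp : ∀ x, pointState m k y b x N ξ
        = (Real.exp (-((y 0 - b) * ∑ r, energy m (ξ r))) : ℂ) * pointState m k y (y 0) x N ξ :=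
      fun x => by rw [pointState_eq_exp_mul m k y b (y 0 - b), add_sub_cancel]
    simp only [hdamp, mul_assoc]
    rw [integral_const_mul, ← wickValue_eq_integral_pointState m f k hy ξ htail, dampedState, damp,
      abs_of_nonneg (sub_nonneg.2 (hb 0))]

lemma coeff_expTwoPoint_eq_genCoeff (m : ℝ) {n : ℕ} (k : Fin n →₀ ℕ) (y : Fin n → ℝ)
    (x : Fin n → Spacetime) :
    MvPowerSeries.coeff k (expTwoPoint m y x) = genCoeff (twoPoints m y x) k 1 :=
  (genCoeff_one _ k).symm

lemma coeff_expTwoPoint_eq_pointState (m : ℝ) {n : ℕ} (k : Fin n →₀ ℕ) (y : Fin n → ℝ) (b : ℝ)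
    (x : Fin n → Spacetime) (ξ : Fin 0 → Momentum) :
    MvPowerSeries.coeff k (expTwoPoint m y x)
      = (∏ a, ((k a)! : ℂ)⁻¹) * pointState m k y b x 0 ξ := by
  have hfact : (∏ a, ((k a)! : ℂ)) ≠ 0 :=
    Finset.prod_ne_zero_iff.2 fun a _ => Nat.cast_ne_zero.2 (k a).factorial_ne_zero
  simp only [coeff_expTwoPoint_eq_genCoeff, pointState, Nat.factorial_zero, Nat.cast_one,
    Real.sqrt_one, Complex.ofReal_one, inv_one, mul_one, Finset.univ_eq_empty, Finset.prod_empty,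
    Finset.prod_inv_distrib, inv_mul_cancel_left₀ hfact]

lemma integrable_coeff_expTwoPoint_mul (m : ℝ) {n : ℕ} (f : Fin n → 𝓢(Spacetime, ℂ))
    (k : Fin n →₀ ℕ) {y : Fin n → ℝ} (hy : StrictMono y) :
    Integrable fun x : Fin n → Spacetime =>
      MvPowerSeries.coeff k (expTwoPoint m y x) * ∏ i, f i (x i) := by
  have htwoPoint : ∀ i j, i < j →
      BddCont fun x : Fin n → Spacetime => twoPoint m (x i - x j) (y i - y j) := fun i j hij =>
    (bddCont_twoPoint m (sub_neg.2 (hy hij))).comp (by fun_prop)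
  obtain ⟨hcont, C, hC⟩ := BddCont.genCoeff htwoPoint (Q := fun _ => 1) (fun _ => BddCont.const _) k
  simp only [coeff_expTwoPoint_eq_genCoeff]
  exact (integrable_prod_schwartz f).bdd_mul hcont.aestronglyMeasurable (ae_of_all _ hC)

lemma integral_coeff_expTwoPoint_mul (m : ℝ) {n : ℕ} (f : Fin n → 𝓢(Spacetime, ℂ))
    (k : Fin n →₀ ℕ) {y : Fin n → ℝ} (hy : StrictMono y) {b : ℝ} (hb : ∀ a, b ≤ y a)
    (ξ : Fin 0 → Momentum) :
    ∫ x : Fin n → Spacetime, MvPowerSeries.coeff k (expTwoPoint m y x) * ∏ i, f i (x i)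
      = (∏ i, ((k i)! : ℂ)⁻¹) * dampedState m f k y b 0 ξ := by
  rw [dampedState_eq_integral m f k hy hb, ← integral_const_mul]
  simp only [coeff_expTwoPoint_eq_pointState m k y b _ ξ, mul_assoc]

end WickExp

end

/-- The identity `(Φ₀, σ^{(1)}(x₁) ⋯ σ^{(n)}(x_n) Φ₀) = exp {∑_{i<j} g_i g_j D_m^{(-)}(x_i - x_j)}`
of formal power series in `g₁, …, g_n` whose coefficients are distributions in `x₁, …, x_n`. Both
sides are smeared with `f₁(x₁) ⋯ f_n(x_n)`; the distributions on the right are the boundary values,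
as `y → 0` with `y₁ < ⋯ < y_n`, of the coefficients at the points with times `x_i⁰ + i y_i`. -/
theorem corollary3p2 (m : ℝ) (hm : 0 ≤ m) (n : ℕ) (f : Fin n → 𝓢(WickExp.Spacetime, ℂ))
    (k : Fin n →₀ ℕ) :
    WickExp.vacuum m ∈ (WickExp.wickExpProdCoeff m f k).domain ∧
    (∀ y : Fin n → ℝ, StrictMono y →
      Integrable (fun x : Fin n → WickExp.Spacetime =>
        MvPowerSeries.coeff k (WickExp.expTwoPoint m y x) * ∏ i, f i (x i))) ∧
    Tendsto
      (fun y : Fin n → ℝ => ∫ x : Fin n → WickExp.Spacetime,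
        MvPowerSeries.coeff k (WickExp.expTwoPoint m y x) * ∏ i, f i (x i))
      (𝓝[{y | StrictMono y}] 0)
      (𝓝 (MvPowerSeries.coeff k (WickExp.vev m f))) := by
  refine ⟨WickExp.vacuum_mem_domain_wickExpProdCoeff m f k,
    fun y hy => WickExp.integrable_coeff_expTwoPoint_mul m f k hy, ?_⟩
  have hlower : ∀ (y : Fin n → ℝ) a, -‖y‖ ≤ y a := fun y a =>
    (abs_le.1 (norm_le_pi_norm y a)).1
  have hcont : Continuous fun y : Fin n → ℝ =>
      (∏ i, ((k i)! : ℂ)⁻¹) * WickExp.dampedState m f k y (-‖y‖) 0 ![] :=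
    continuous_const.mul (((WickExp.rapidFamily_dampedState m f k).cont 0).comp
      (show Continuous fun y : Fin n → ℝ => ((y, -‖y‖), ![]) by fun_prop))
  have hlim := hcont.tendsto 0
  rw [norm_zero, neg_zero, ← WickExp.coeff_vev] at hlim
  refine (hlim.mono_left nhdsWithin_le_nhds).congr' ?_
  filter_upwards [self_mem_nhdsWithin] with y hy
  exact (WickExp.integral_coeff_expTwoPoint_mul m f k hy (hlower y) ![]).symm
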